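/- Let $d\ge 1$. A rectangle in $\mathbf R^d$ is a product $\prod_{i=1}^d[a_i,b_i)$ of left-closed right-open bounded intervals, and a multirectangle is a finite union of rectangles. For a multirectangle $M\subseteq\mathbf R^d$, let $\operatorname{Rec}_d(M)$ be the group of all permutations $f$ of $M$ for which there is a finite partition of $M$ into rectangles on each of which $f$ is a translation. For real numbers $u\le c\le v$, the restricted rotation exchanging $[u,c)$ and $[c,v)$ is the permutation $s$ of $\mathbf R$ with $s(t)=t+(v-c)$ for $t\in[u,c)$, $s(t)=t-(c-u)$ for $t\in[c,v)$, and $s(t)=t$ otherwise. A restricted shuffle of $M$ is a permutation of $M$ determined by a direction $i\in\{1,\dots,d\}$, a rectangle $\prod_{j=1}^d[a_j,b_j)$ contained in $M$ and a number $c\in[a_i,b_i]$, as follows: if $x_j\in[a_j,b_j)$ for all $j\ne i$, then $x$ is mapped to the point obtained from $x$ by replacing $x_i$ with $s(x_i)$, where $s$ is the restricted rotation exchanging $[a_i,c)$ and $[c,b_i)$; every other point of $M$ is fixed. Then for every multirectangle $M\subseteq\mathbf R^d$ with connected interior, $\operatorname{Rec}_d(M)$ is generated by restricted shuffles: the subgroup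 of the group of permutations of $M$ generated by the restricted shuffles of $M$ equals $\operatorname{Rec}_d(M)$. (The empty multirectangle is allowed.) -/

import Mathlib

namespace RectExchange

/-- The half-open box `∏ i, [a i, b i)` in `ℝ^d`. -/
def box {d : ℕ} (a b : Fin d → ℝ) : Set (Fin d → ℝ) :=
  Set.pi Set.univ (fun i => Set.Ico (a i) (b i))

/-- A rectangle in `ℝ^d`: a product of left-closed right-open bounded intervals
(the empty set is allowed as a degenerate rectangle). -/
def IsRectangle {d : ℕ} (P : Set (Fin d → ℝ)) : Prop :=
  ∃ a b : Fin d → ℝ, P = box a b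

/-- A multirectangle: a finite union of rectangles. -/
def IsMultirectangle {d : ℕ} (M : Set (Fin d → ℝ)) : Prop :=
  ∃ 𝒜 : Set (Set (Fin d → ℝ)), 𝒜.Finite ∧ (∀ P ∈ 𝒜, IsRectangle P) ∧ M = ⋃₀ 𝒜

/-- `𝒜` is a finite partition of `M` into rectangles. -/
structure IsRectanglePartition {d : ℕ} (M : Set (Fin d → ℝ))
    (𝒜 : Set (Set (Fin d → ℝ))) : Prop where
  finite : 𝒜.Finite
  isRectangle : ∀ P ∈ 𝒜, IsRectangle P
  disjoint : 𝒜.PairwiseDisjoint id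
  sUnion_eq : ⋃₀ 𝒜 = M

/-- A permutation `f` of `M` is a rectangle exchange transformation if there is a finite partition
of `M` into rectangles on each of which `f` is a translation. -/
def IsRectangleExchange {d : ℕ} {M : Set (Fin d → ℝ)} (f : Equiv.Perm M) : Prop :=
  ∃ 𝒜 : Set (Set (Fin d → ℝ)), IsRectanglePartition M 𝒜 ∧
    ∀ P ∈ 𝒜, ∃ v : Fin d → ℝ, ∀ x : M, (x : Fin d → ℝ) ∈ P → (f x : Fin d → ℝ) = x + v

theorem mem_box {d : ℕ} {a b x : Fin d → ℝ} : x ∈ box a b ↔ ∀ i, a i ≤ x i ∧ x i < b i := by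
  simp [box, Set.mem_pi]

theorem IsRectangle.inter {d : ℕ} {P Q : Set (Fin d → ℝ)} (hP : IsRectangle P)
    (hQ : IsRectangle Q) : IsRectangle (P ∩ Q) := by
  obtain ⟨a, b, rfl⟩ := hP
  obtain ⟨a', b', rfl⟩ := hQ
  refine ⟨fun i => max (a i) (a' i), fun i => min (b i) (b' i), ?_⟩
  ext x
  simp only [Set.mem_inter_iff, mem_box, max_le_iff, lt_min_iff, ← forall_and]
  exact forall_congr' fun i => by tauto

theorem IsRectangle.preimage_add {d : ℕ} {P : Set (Fin d → ℝ)} (hP : IsRectangle P)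
    (v : Fin d → ℝ) : IsRectangle ((fun x => x + v) ⁻¹' P) := by
  obtain ⟨a, b, rfl⟩ := hP
  refine ⟨a - v, b - v, ?_⟩
  ext x
  simp only [Set.mem_preimage, mem_box, Pi.add_apply, Pi.sub_apply]
  exact forall_congr' fun i => by rw [sub_le_iff_le_add, lt_sub_iff_add_lt]

theorem exists_partition_sdiff {d : ℕ} {s t : Set (Fin d → ℝ)} (hs : IsRectangle s)
    (ht : IsRectangle t) : ∃ 𝒜, IsRectanglePartition (s \ t) 𝒜 := by
  obtain ⟨a', b', rfl⟩ := ht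
  by_cases hne : ∃ i, b' i ≤ a' i
  · obtain ⟨i, hi⟩ := hne
    have hempty : box a' b' = ∅ := by
      ext x
      simp only [mem_box, Set.mem_empty_iff_false, iff_false]
      intro h
      exact absurd (lt_of_le_of_lt (h i).1 (h i).2) (not_lt.2 hi)
    exact ⟨{s}, Set.finite_singleton s, by simpa using hs, by simp, by simp [hempty]⟩
  push Not at hne
  let c : Fin d → Fin 3 → ℝ → Prop := fun i k y =>
    if k = 0 then y < a' i else if k = 1 then a' i ≤ y ∧ y < b' i else b' i ≤ y
  let piece : (Fin d → Fin 3) → Set (Fin d → ℝ) := fun σ => {x | x ∈ s ∧ ∀ i, c i (σ i) (x i)}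
  refine ⟨piece '' {σ | σ ≠ fun _ => 1}, (Set.toFinite _).image _, ?_, ?_, ?_⟩
  · rintro _ ⟨σ, -, rfl⟩
    obtain ⟨a, b, rfl⟩ := hs
    refine ⟨fun i => if σ i = 0 then a i else if σ i = 1 then max (a i) (a' i)
        else max (a i) (b' i),
      fun i => if σ i = 0 then min (b i) (a' i) else if σ i = 1 then min (b i) (b' i)
        else b i, ?_⟩
    ext x
    simp only [piece, c, Set.mem_ofPred_eq, mem_box, ← forall_and]
    refine forall_congr' fun i => ?_
    split_ifs <;> simp only [max_le_iff, lt_min_iff] <;> tauto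
  · rintro _ ⟨σ, -, rfl⟩ _ ⟨τ, -, rfl⟩ hστ
    refine Set.disjoint_left.2 fun x hx hx' => hστ ?_
    have : σ = τ := by
      funext i
      have h1 := hx.2 i
      have h2 := hx'.2 i
      have h3 := hne i
      simp only [c] at h1 h2
      generalize σ i = k at h1
      generalize τ i = l at h2
      fin_cases k <;> fin_cases l <;> simp at h1 h2 ⊢ <;> linarith
    rw [this]
  · ext x
    simp only [Set.mem_sUnion, Set.mem_image, Set.mem_sdiff, mem_box]
    constructor
    · rintro ⟨_, ⟨σ, hσ, rfl⟩, hx, hx'⟩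
      refine ⟨hx, fun h => hσ ?_⟩
      funext i
      have h1 := hx' i
      have h2 := h i
      simp only [c] at h1
      generalize σ i = k at h1
      fin_cases k <;> simp at h1 ⊢ <;> linarith
    · rintro ⟨hx, hx'⟩
      refine ⟨_, ⟨fun i => if x i < a' i then 0 else if x i < b' i then 1 else 2, ?_, rfl⟩, hx, ?_⟩
      · intro h
        apply hx'
        intro i
        have h1 := congrFun h i
        by_cases h2 : x i < a' i
        · simp [h2] at h1
        · by_cases h3 : x i < b' i
          · exact ⟨not_lt.1 h2, h3⟩
          · simp [h2, h3] at h1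
      · intro i
        simp only [c]
        by_cases h2 : x i < a' i
        · simp [h2]
        · by_cases h3 : x i < b' i
          · simp [h2, h3, not_lt.1 h2]
          · simp [h2, h3, not_lt.1 h3]

/-- Every multirectangle has a finite partition into rectangles. -/
theorem IsMultirectangle.exists_partition {d : ℕ} {M : Set (Fin d → ℝ)}
    (hM : IsMultirectangle M) : ∃ 𝒜, IsRectanglePartition M 𝒜 := by
  classical
  obtain ⟨𝒮, h𝒮, hrect, rfl⟩ := hM
  rcases Nat.eq_zero_or_pos d with rfl | hd
  · refine ⟨{⋃₀ 𝒮} \ {∅}, (Set.finite_singleton _).subset Set.sdiff_subset, ?_, ?_, ?_⟩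
    · rintro P ⟨-, hP⟩
      refine ⟨0, 0, ?_⟩
      obtain ⟨x, hx⟩ := Set.nonempty_iff_ne_empty.2 hP
      ext y
      simp [mem_box, Subsingleton.elim y x, hx]
    · exact (Set.pairwiseDisjoint_singleton _ _).subset Set.sdiff_subset
    · exact Set.sUnion_sdiff_singleton_empty _ |>.trans (Set.sUnion_singleton _)
  have hC : MeasureTheory.IsSetSemiring {P : Set (Fin d → ℝ) | IsRectangle P} := by
    refine ⟨⟨0, 0, ?_⟩, fun s hs t ht => IsRectangle.inter hs ht, fun s hs t ht => ?_⟩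
    · ext x
      simp only [Set.mem_empty_iff_false, mem_box, false_iff]
      intro h
      exact absurd (lt_of_le_of_lt (h ⟨0, hd⟩).1 (h ⟨0, hd⟩).2) (lt_irrefl _)
    · obtain ⟨𝒜, hfin, hr, hdis, hU⟩ := exists_partition_sdiff hs ht
      refine ⟨hfin.toFinset, ?_, ?_, ?_⟩
      · intro P hP
        exact hr P (by simpa using hP)
      · simpa using hdis
      · simpa using hU.symm
  have hJ : (↑h𝒮.toFinset : Set (Set (Fin d → ℝ))) ⊆ {P | IsRectangle P} := by
    intro P hP
    exact hrect P (by simpa using hP)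
  obtain ⟨K, -, hK, hdis, -, -, hU⟩ := hC.disjointOfUnion_props hJ
  refine ⟨⋃ x ∈ h𝒮.toFinset, (K x : Set (Set (Fin d → ℝ))), ?_, ?_, hdis, ?_⟩
  · exact Set.Finite.biUnion (Finset.finite_toSet _) fun _ _ => Finset.finite_toSet _
  · intro P hP
    obtain ⟨i, hi, hPi⟩ := Set.mem_iUnion₂.1 hP
    exact hK i hi hPi
  · simpa using hU.symm

theorem IsRectanglePartition.subset {d : ℕ} {M P : Set (Fin d → ℝ)}
    {𝒜 : Set (Set (Fin d → ℝ))} (h : IsRectanglePartition M 𝒜) (hP : P ∈ 𝒜) : P ⊆ M :=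
  h.sUnion_eq ▸ Set.subset_sUnion_of_mem hP

theorem IsRectanglePartition.exists_mem {d : ℕ} {M : Set (Fin d → ℝ)}
    {𝒜 : Set (Set (Fin d → ℝ))} (h : IsRectanglePartition M 𝒜) {x : Fin d → ℝ} (hx : x ∈ M) :
    ∃ P ∈ 𝒜, x ∈ P := by
  rw [← h.sUnion_eq] at hx
  exact hx

theorem IsRectangleExchange.one {d : ℕ} {M : Set (Fin d → ℝ)} (hM : IsMultirectangle M) :
    IsRectangleExchange (1 : Equiv.Perm M) := by
  obtain ⟨𝒜, h𝒜⟩ := hM.exists_partition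
  exact ⟨𝒜, h𝒜, fun P _ => ⟨0, fun x _ => by simp⟩⟩

theorem IsRectangleExchange.mul {d : ℕ} {M : Set (Fin d → ℝ)} {f g : Equiv.Perm M}
    (hf : IsRectangleExchange f) (hg : IsRectangleExchange g) : IsRectangleExchange (f * g) := by
  obtain ⟨𝒜, h𝒜, hf⟩ := hf
  obtain ⟨𝒬, h𝒬, hg⟩ := hg
  choose! v hv using hf
  choose! w hw using hg
  refine ⟨(fun p : Set (Fin d → ℝ) × Set (Fin d → ℝ) => p.2 ∩ (fun x => x + w p.2) ⁻¹' p.1) ''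
    (𝒜 ×ˢ 𝒬), ⟨(h𝒜.finite.prod h𝒬.finite).image _, ?_, ?_, ?_⟩, ?_⟩
  · rintro _ ⟨⟨P, Q⟩, ⟨hP, hQ⟩, rfl⟩
    exact (h𝒬.isRectangle Q hQ).inter ((h𝒜.isRectangle P hP).preimage_add _)
  · rintro _ ⟨⟨P, Q⟩, ⟨hP, hQ⟩, rfl⟩ _ ⟨⟨P', Q'⟩, ⟨hP', hQ'⟩, rfl⟩ hne
    refine Set.disjoint_left.2 fun x hx hx' => hne ?_
    simp only [id, Set.mem_inter_iff, Set.mem_preimage] at hx hx' hP hQ hP' hQ'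
    have e1 : Q = Q' := h𝒬.disjoint.elim_set hQ hQ' x hx.1 hx'.1
    subst e1
    have e2 : P = P' := h𝒜.disjoint.elim_set hP hP' _ hx.2 hx'.2
    subst e2
    rfl
  · ext x
    constructor
    · rintro ⟨_, ⟨⟨P, Q⟩, ⟨hP, hQ⟩, rfl⟩, hx⟩
      exact h𝒬.subset hQ hx.1
    · intro hx
      obtain ⟨Q, hQ, hxQ⟩ := h𝒬.exists_mem hx
      obtain ⟨P, hP, hxP⟩ := h𝒜.exists_mem (g ⟨x, hx⟩).2
      refine ⟨_, ⟨(P, Q), ⟨hP, hQ⟩, rfl⟩, hxQ, ?_⟩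
      rw [hw Q hQ ⟨x, hx⟩ hxQ] at hxP
      exact hxP
  · rintro _ ⟨⟨P, Q⟩, ⟨hP, hQ⟩, rfl⟩
    refine ⟨w Q + v P, fun x hx => ?_⟩
    have h1 := hw Q hQ x hx.1
    rw [Equiv.Perm.mul_apply, hv P hP (g x) (by rw [h1]; exact hx.2), h1, add_assoc]

theorem IsRectangleExchange.inv {d : ℕ} {M : Set (Fin d → ℝ)} {f : Equiv.Perm M}
    (hf : IsRectangleExchange f) : IsRectangleExchange f⁻¹ := by
  obtain ⟨𝒜, h𝒜, hf⟩ := hf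
  choose! v hv using hf
  have key : ∀ P ∈ 𝒜, ∀ x, x + -v P ∈ P → ∃ hx : x ∈ M,
      ((f⁻¹ ⟨x, hx⟩ : M) : Fin d → ℝ) = x + -v P := by
    intro P hP x hx
    have h1 := hv P hP ⟨_, h𝒜.subset hP hx⟩ hx
    have h2 : (f ⟨_, h𝒜.subset hP hx⟩ : Fin d → ℝ) = x := by rw [h1]; simp
    have hxM : x ∈ M := by rw [← h2]; exact (f _).2
    refine ⟨hxM, ?_⟩
    have h3 : f ⟨_, h𝒜.subset hP hx⟩ = ⟨x, hxM⟩ := Subtype.ext h2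
    rw [← h3]
    simp
  refine ⟨(fun P => (fun x => x + -v P) ⁻¹' P) '' 𝒜, ⟨h𝒜.finite.image _, ?_, ?_, ?_⟩, ?_⟩
  · rintro _ ⟨P, hP, rfl⟩
    exact (h𝒜.isRectangle P hP).preimage_add _
  · rintro _ ⟨P, hP, rfl⟩ _ ⟨P', hP', rfl⟩ hne
    refine Set.disjoint_left.2 fun x hx hx' => hne ?_
    obtain ⟨hxM, e⟩ := key P hP x hx
    obtain ⟨_, e'⟩ := key P' hP' x hx'
    have ee : x + -v P' = x + -v P := e'.symm.trans e
    have hx'' : x + -v P' ∈ P' := hx'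
    have : P = P' := h𝒜.disjoint.elim_set hP hP' (x + -v P) hx (by rwa [ee] at hx'')
    rw [this]
  · ext x
    constructor
    · rintro ⟨_, ⟨P, hP, rfl⟩, hx⟩
      exact (key P hP x hx).1
    · intro hx
      obtain ⟨P, hP, hxP⟩ := h𝒜.exists_mem (f⁻¹ ⟨x, hx⟩).2
      refine ⟨_, ⟨P, hP, rfl⟩, ?_⟩
      have h0 : f (f⁻¹ ⟨x, hx⟩) = ⟨x, hx⟩ := by simp
      have h1 := hv P hP _ hxP
      rw [h0] at h1
      simp only [Set.mem_preimage]
      rw [show x = _ from h1]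
      simpa using hxP
  · rintro _ ⟨P, hP, rfl⟩
    exact ⟨-v P, fun x hx => (key P hP x hx).2⟩

/-- The group `Rec_d(M)` of rectangle exchange transformations of a multirectangle `M`, as a
subgroup of the group of all permutations of `M`. -/
def Rec {d : ℕ} (M : Set (Fin d → ℝ)) (hM : IsMultirectangle M) : Subgroup (Equiv.Perm M) where
  carrier := {f | IsRectangleExchange f}
  one_mem' := IsRectangleExchange.one hM
  mul_mem' := IsRectangleExchange.mul
  inv_mem' := IsRectangleExchange.inv

/-- The restricted rotation of the line exchanging the two consecutive intervals `[u, c)` and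
`[c, v)` by translations, and fixing every point outside `[u, v)`. -/
noncomputable def restrictedRotation (u c v t : ℝ) : ℝ :=
  if u ≤ t ∧ t < c then t + (v - c) else if c ≤ t ∧ t < v then t - (c - u) else t

/-- `f` is a restricted shuffle of `M` in direction `i`: for some rectangle
`∏ j, [a j, b j)` contained in `M` and some `c` in `[a i, b i]`, `f` applies to the `i`-th
coordinate the restricted rotation exchanging `[a i, c)` and `[c, b i)` at the points all of whose
other coordinates `x j` lie in `[a j, b j)`, and `f` fixes all other points. -/
def IsRestrictedShuffle {d : ℕ} {M : Set (Fin d → ℝ)} (f : Equiv.Perm M) : Prop :=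
  ∃ (i : Fin d) (a b : Fin d → ℝ) (c : ℝ), a i ≤ c ∧ c ≤ b i ∧ box a b ⊆ M ∧
    ∀ x : M,
      ((∀ j, j ≠ i → x.1 j ∈ Set.Ico (a j) (b j)) →
        (f x).1 = Function.update x.1 i (restrictedRotation (a i) c (b i) (x.1 i))) ∧
      ((¬ ∀ j, j ≠ i → x.1 j ∈ Set.Ico (a j) (b j)) → f x = x)

end RectExchange

namespace RectExchange
open Set

/-! ### Interval exchanges of the line -/

/-! A rectangle exchange `f` is first corrected by shuffles until it permutes the cells of a fixed
grid by translations. It is then a product of transpositions of congruent cells, and these are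
treated one at a time.

The grid comes from arithmetic of lengths. Let `S` contain all endpoint coordinates of the
rectangles `P` of a partition for `f` and of their images. The gaps of `S` may be rationally
independent, or related in awkward ways, so `P` and `f(P)` need not be cut alike by `S`. However,
finitely many positive reals can be written as natural combinations of positive reals, with
multiplicities given on them by `ℚ`-linear forms (`exists_decomposition`). Cutting every gap
accordingly makes intervals of equal length with endpoints in `S` consist of the same tiles up to
order (`exists_words`, `exists_tiling`). Reordering the tiles in each coordinate of `f(P)` is a
product of shuffles inside `f(P)`, so some `k` in the shuffle group makes `k * f` carry cells to
cells.

For two disjoint congruent boxes in `M`, the swap is a product of shuffles. Inside one rectangle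
this is done coordinate by coordinate. For boxes small enough, being swappable is an equivalence
relation between corners which is locally constant on the interior, so connectedness makes it total.
Large boxes are subdivided into small ones and the swaps are glued (`boxSwap_of_connected`).

The reverse inclusion only needs a partition of `M` adapted to one shuffle. -/

theorem restrictedRotation_restrictedRotation {u c v : ℝ} (h₁ : u ≤ c) (h₂ : c ≤ v) (t : ℝ) :
    restrictedRotation u (u + v - c) v (restrictedRotation u c v t) = t := by
  unfold restrictedRotation
  split_ifs <;> grind

/-- The restricted rotation as a permutation of the line. -/
noncomputable def rotation (u c v : ℝ) (h₁ : u ≤ c) (h₂ : c ≤ v) : Equiv.Perm ℝ where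
  toFun := restrictedRotation u c v
  -- After the exchange the interval of length `v - c` comes first, so the inverse cuts at `u + (v -
  -- c)`.
  invFun := restrictedRotation u (u + v - c) v
  left_inv := restrictedRotation_restrictedRotation h₁ h₂
  right_inv t := by
    have := restrictedRotation_restrictedRotation (u := u) (c := u + v - c) (v := v)
      (by linarith) (by linarith) t
    rwa [show u + v - (u + v - c) = c by ring] at this

@[simp] theorem rotation_apply {u c v : ℝ} (h₁ : u ≤ c) (h₂ : c ≤ v) (t : ℝ) :
    rotation u c v h₁ h₂ t = restrictedRotation u c v t := rfl

/-- The group of permutations of the line generated by the restricted rotations inside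
`[a, b)`. -/
def iet (a b : ℝ) : Subgroup (Equiv.Perm ℝ) :=
  Subgroup.closure {σ | ∃ u c v, a ≤ u ∧ u ≤ c ∧ c ≤ v ∧ v ≤ b ∧
    ∀ t, σ t = restrictedRotation u c v t}

theorem rotation_mem_iet {a b u c v : ℝ} (h₁ : u ≤ c) (h₂ : c ≤ v) (ha : a ≤ u) (hb : v ≤ b) :
    rotation u c v h₁ h₂ ∈ iet a b :=
  Subgroup.subset_closure ⟨u, c, v, ha, h₁, h₂, hb, fun _ => rfl⟩

theorem iet_mono {a b a' b' : ℝ} (ha : a' ≤ a) (hb : b ≤ b') : iet a b ≤ iet a' b' :=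
  Subgroup.closure_mono fun _ ⟨u, c, v, h₁, h₂, h₃, h₄, h⟩ =>
    ⟨u, c, v, ha.trans h₁, h₂, h₃, h₄.trans hb, h⟩

theorem iet_apply_of_notMem {a b : ℝ} {σ : Equiv.Perm ℝ} (hσ : σ ∈ iet a b) :
    ∀ t, t ∉ Ico a b → σ t = t := by
  induction hσ using Subgroup.closure_induction with
  | mem σ h =>
    obtain ⟨u, c, v, h₁, h₂, h₃, h₄, h⟩ := h
    intro t ht
    rw [h, restrictedRotation]
    simp only [mem_Ico] at ht
    split_ifs <;> grind
  | one => simp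
  | mul σ τ _ _ h₁ h₂ => intro t ht; rw [Equiv.Perm.mul_apply, h₂ t ht, h₁ t ht]
  | inv σ _ h => intro t ht; rw [Equiv.Perm.inv_eq_iff_eq, h t ht]

theorem iet_apply_mem {a b : ℝ} {σ : Equiv.Perm ℝ} (hσ : σ ∈ iet a b) {t : ℝ}
    (ht : t ∈ Ico a b) : σ t ∈ Ico a b := by
  by_contra h
  exact h (by rwa [σ.injective (iet_apply_of_notMem hσ _ h)])

/-- With consecutive blocks `X Y Z`, where `X` and `Z` have length `l`, one rotation gives `Z X Y`
and a second one, on the last two blocks, gives `Z Y X`. -/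
theorem exists_iet_swap {u t l : ℝ} (hl : 0 ≤ l) (ht : l ≤ t) :
    ∃ σ ∈ iet u (u + t + l), ∀ s, σ s = if s ∈ Ico u (u + l) then s + t else
      if s - t ∈ Ico u (u + l) then s - t else s := by
  refine ⟨rotation (u + l) (u + 2 * l) (u + t + l) (by linarith) (by linarith) *
    rotation u (u + t) (u + t + l) (by linarith) (by linarith),
    mul_mem (rotation_mem_iet _ _ (by linarith) le_rfl) (rotation_mem_iet _ _ le_rfl le_rfl), ?_⟩
  intro s
  simp only [Equiv.Perm.mul_apply, rotation_apply, restrictedRotation, mem_Ico]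
  grind

/-! ### Tilings of an interval by a list of lengths -/

/-- `[s, s + l)` is one of the consecutive intervals, starting at `a`, whose lengths are the
entries of a list. -/
def IsTile : ℝ → List ℝ → ℝ → ℝ → Prop
  | _, [], _, _ => False
  | a, e :: w, s, l => (s = a ∧ l = e) ∨ IsTile (a + e) w s l

theorem isTile_append {w w' : List ℝ} {a s l : ℝ} :
    IsTile a (w ++ w') s l ↔ IsTile a w s l ∨ IsTile (a + w.sum) w' s l := by
  induction w generalizing a with
  | nil => simp [IsTile]
  | cons e w ih => simp [IsTile, ih, or_assoc, add_assoc]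

theorem isTile_add {w : List ℝ} {a s l v : ℝ} (h : IsTile a w s l) :
    IsTile (a + v) w (s + v) l := by
  induction w generalizing a with
  | nil => exact h
  | cons e w ih =>
    rcases h with ⟨rfl, rfl⟩ | h
    · exact Or.inl ⟨rfl, rfl⟩
    · refine Or.inr ?_
      rw [add_right_comm]
      exact ih h

theorem IsTile.mem {w : List ℝ} {a s l : ℝ} (h : IsTile a w s l) : l ∈ w := by
  induction w generalizing a with
  | nil => exact h.elim
  | cons e w ih =>
    rcases h with ⟨-, rfl⟩ | h
    · simp
    · exact List.mem_cons_of_mem _ (ih h)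

theorem IsTile.le {w : List ℝ} {a s l : ℝ} (h : IsTile a w s l) (hw : ∀ e ∈ w, 0 ≤ e) :
    a ≤ s ∧ s + l ≤ a + w.sum := by
  induction w generalizing a with
  | nil => exact h.elim
  | cons e w ih =>
    have hw' : ∀ e ∈ w, 0 ≤ e := fun x hx => hw x (List.mem_cons_of_mem _ hx)
    have h0 := List.sum_nonneg hw'
    have he := hw e (by simp)
    rcases h with ⟨rfl, rfl⟩ | h
    · simp only [List.sum_cons]
      constructor <;> linarith
    · have := ih h hw'
      simp only [List.sum_cons]
      constructor <;> linarith

theorem finite_isTile (a : ℝ) (w : List ℝ) : {p : ℝ × ℝ | IsTile a w p.1 p.2}.Finite := by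
  induction w generalizing a with
  | nil => simp [IsTile]
  | cons e w ih =>
    refine ((Set.finite_singleton (a, e)).union (ih (a + e))).subset ?_
    rintro ⟨s, l⟩ (⟨rfl, rfl⟩ | h)
    · exact Or.inl rfl
    · exact Or.inr h

theorem IsTile.eq_of_mem {w : List ℝ} {a s l s' l' t : ℝ} (h : IsTile a w s l)
    (h' : IsTile a w s' l') (hw : ∀ e ∈ w, 0 ≤ e) (ht : t ∈ Ico s (s + l))
    (ht' : t ∈ Ico s' (s' + l')) : s = s' ∧ l = l' := by
  induction w generalizing a with
  | nil => exact h.elim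
  | cons e w ih =>
    have hw' : ∀ e ∈ w, 0 ≤ e := fun x hx => hw x (List.mem_cons_of_mem _ hx)
    rcases h with ⟨rfl, rfl⟩ | h <;> rcases h' with ⟨rfl, rfl⟩ | h'
    · exact ⟨rfl, rfl⟩
    · have := h'.le hw'
      linarith [ht.2, ht'.1]
    · have := h.le hw'
      linarith [ht'.2, ht.1]
    · exact ih h h' hw'

theorem exists_isTile {w : List ℝ} {a t : ℝ} (ht : t ∈ Ico a (a + w.sum)) :
    ∃ s l, IsTile a w s l ∧ t ∈ Ico s (s + l) := by
  induction w generalizing a with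
  | nil => simp at ht
  | cons e w ih =>
    by_cases h : t < a + e
    · exact ⟨a, e, Or.inl ⟨rfl, rfl⟩, ht.1, h⟩
    · obtain ⟨s, l, h, h'⟩ := ih (a := a + e) ⟨not_lt.1 h, by
        have := ht.2
        rw [List.sum_cons] at this
        linarith⟩
      exact ⟨s, l, Or.inr h, h'⟩

/-- A permutation of a list is a product of adjacent transpositions, and transposing two adjacent
tiles is exactly one restricted rotation. -/
theorem exists_iet_of_perm {w w' : List ℝ} (h : w.Perm w') (hw : ∀ e ∈ w, 0 ≤ e) (a : ℝ) :
    ∃ σ ∈ iet a (a + w.sum), ∀ s l, IsTile a w s l →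
      ∃ s', IsTile a w' s' l ∧ ∀ t ∈ Ico s (s + l), σ t = t + (s' - s) := by
  induction h generalizing a with
  | nil => exact ⟨1, one_mem _, fun s l h => h.elim⟩
  | @cons e w w' _ ih =>
    have hw' : ∀ e ∈ w, 0 ≤ e := fun x hx => hw x (List.mem_cons_of_mem _ hx)
    have he := hw e (by simp)
    obtain ⟨σ, hσ, h⟩ := ih hw' (a + e)
    refine ⟨σ, iet_mono (by linarith) (by rw [List.sum_cons]; linarith) hσ, ?_⟩
    rintro s l (⟨rfl, rfl⟩ | hs)
    · refine ⟨s, Or.inl ⟨rfl, rfl⟩, fun t ht => ?_⟩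
      rw [iet_apply_of_notMem hσ t (fun h => absurd ht.2 (not_lt.2 h.1))]
      ring
    · obtain ⟨s', hs', h⟩ := h s l hs
      exact ⟨s', Or.inr hs', h⟩
  | swap x y w =>
    have hx : 0 ≤ x := hw x (by simp)
    have hy : 0 ≤ y := hw y (by simp)
    have hw' : ∀ e ∈ w, 0 ≤ e := fun x hx => hw x (by simp [hx])
    have h0 := List.sum_nonneg hw'
    refine ⟨rotation a (a + y) (a + y + x) (by linarith) (by linarith),
      rotation_mem_iet _ _ le_rfl (by simp only [List.sum_cons]; linarith), ?_⟩
    simp only [rotation_apply, restrictedRotation, mem_Ico]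
    rintro s l (⟨rfl, rfl⟩ | ⟨rfl, rfl⟩ | hs)
    · exact ⟨s + x, Or.inr (Or.inl ⟨rfl, rfl⟩), by grind⟩
    · exact ⟨a, Or.inl ⟨rfl, rfl⟩, by grind⟩
    · refine ⟨s, Or.inr (Or.inr (by rwa [add_right_comm])), ?_⟩
      have := hs.le hw'
      grind
  | @trans w₁ w₂ w₃ h₁ h₂ ih₁ ih₂ =>
    obtain ⟨σ, hσ, h⟩ := ih₁ hw a
    obtain ⟨τ, hτ, h'⟩ := ih₂ (fun e he => hw e (h₁.mem_iff.2 he)) a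
    rw [← h₁.sum_eq] at hτ
    refine ⟨τ * σ, mul_mem hτ hσ, fun s l hs => ?_⟩
    obtain ⟨s', hs', e⟩ := h s l hs
    obtain ⟨s'', hs'', e'⟩ := h' s' l hs'
    refine ⟨s'', hs'', fun t ht => ?_⟩
    rw [Equiv.Perm.mul_apply, e t ht, e' _ ⟨by linarith [ht.1], by linarith [ht.2]⟩]
    ring

/-! ### Decomposition of finitely many lengths -/

/-- The inclusion of the `ℚ`-span of `F` into `ℝ` is positive on `F`. In a basis of the span it is a
real vector of coefficients. Positivity on a finite set is an open condition on that vector, so a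
nearby rational vector also works. -/
theorem exists_linearMap_pos (F : Set ℝ) (hF : F.Finite) (hpos : ∀ x ∈ F, 0 < x) :
    ∃ L : ℝ →ₗ[ℚ] ℚ, ∀ x ∈ F, 0 < L x := by
  classical
  let V := Submodule.span ℚ F
  have : FiniteDimensional ℚ V := FiniteDimensional.span_of_finite ℚ hF
  let b := Module.finBasis ℚ V
  have hopen : IsOpen (⋂ x : F, {r : Fin (Module.finrank ℚ V) → ℝ |
      0 < ∑ i, (b.repr ⟨x, Submodule.subset_span x.2⟩ i : ℝ) * r i}) := by
    have := hF.to_subtype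
    exact isOpen_iInter_of_finite fun x => isOpen_lt continuous_const (by fun_prop)
  have hne : (fun i => ((b i : V) : ℝ)) ∈ (⋂ x : F, {r : Fin (Module.finrank ℚ V) → ℝ |
      0 < ∑ i, (b.repr ⟨x, Submodule.subset_span x.2⟩ i : ℝ) * r i}) := by
    simp only [mem_iInter, mem_ofPred_eq]
    intro x
    have h := congrArg (fun v : V => (v : ℝ)) (b.sum_repr ⟨x, Submodule.subset_span x.2⟩)
    simp only [AddSubmonoidClass.coe_finsetSum, Submodule.coe_smul, Rat.smul_def] at h
    rw [h]
    exact hpos x x.2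
  have hdense : DenseRange (fun (r : Fin (Module.finrank ℚ V) → ℚ) i => (r i : ℝ)) :=
    DenseRange.piMap fun _ => Rat.denseRange_cast
  obtain ⟨r, hr⟩ := hdense.exists_mem_open hopen ⟨_, hne⟩
  obtain ⟨L, hL⟩ := LinearMap.exists_extend (b.constr ℚ r)
  refine ⟨L, fun x hx => ?_⟩
  have h1 : L x = b.constr ℚ r ⟨x, Submodule.subset_span hx⟩ := by rw [← hL]; rfl
  have h2 := mem_iInter.1 hr ⟨x, hx⟩
  rw [h1, Module.Basis.constr_apply_fintype]
  simp only [mem_ofPred_eq] at h2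
  simp only [Module.Basis.equivFun_apply, smul_eq_mul]
  exact_mod_cast h2

theorem exists_linearMap_natCast_pos (F : Set ℝ) (hF : F.Finite) (hpos : ∀ x ∈ F, 0 < x) :
    ∃ L : ℝ →ₗ[ℚ] ℚ, ∀ x ∈ F, ∃ n : ℕ, 0 < n ∧ L x = n := by
  classical
  obtain ⟨L, hL⟩ := exists_linearMap_pos F hF hpos
  let D : ℕ := ∏ x ∈ hF.toFinset, (L x).den
  have hD : 0 < D := Finset.prod_pos fun x _ => (L x).den_pos
  refine ⟨(D : ℚ) • L, fun x hx => ?_⟩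
  obtain ⟨k, hk⟩ : (L x).den ∣ D := Finset.dvd_prod_of_mem _ (by simpa using hx)
  have h1 : ((D : ℚ) • L) x = (k * (L x).num : ℤ) := by
    rw [LinearMap.smul_apply, smul_eq_mul, hk]
    push_cast
    rw [mul_comm ((L x).den : ℚ), mul_assoc, Rat.den_mul_eq_num]
  have h2 : 0 < ((D : ℚ) • L) x := mul_pos (by exact_mod_cast hD) (hL x hx)
  rw [h1] at h2 ⊢
  have h3 : 0 < (k * (L x).num : ℤ) := by exact_mod_cast h2
  lift (k * (L x).num : ℤ) to ℕ using h3.le with n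
  exact ⟨n, by exact_mod_cast h3, by simp⟩

/-- A `ℚ`-linear form which is nonnegative on a finite set `F` is, on `F`, a positive combination
of `ℚ`-linear forms with natural values on `F`. -/
theorem exists_decomposition (F : Finset ℝ) (φ : ℝ →ₗ[ℚ] ℝ) (hφ : ∀ x ∈ F, 0 ≤ φ x) :
    ∃ K : List (ℝ × (ℝ →ₗ[ℚ] ℚ)), (∀ p ∈ K, 0 < p.1 ∧ ∀ x ∈ F, ∃ n : ℕ, p.2 x = n) ∧
      ∀ x ∈ F, φ x = (K.map fun p => p.1 * (p.2 x : ℝ)).sum := by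
  classical
  induction hn : (F.filter fun x => 0 < φ x).card using Nat.strong_induction_on generalizing φ with
  | _ n ih =>
  rcases (F.filter fun x => 0 < φ x).eq_empty_or_nonempty with he | hne
  · refine ⟨[], by simp, fun x hx => ?_⟩
    have : ¬ 0 < φ x := fun h => by
      have : x ∈ F.filter fun x => 0 < φ x := by simp [hx, h]
      simp [he] at this
    simpa using le_antisymm (not_lt.1 this) (hφ x hx)
  obtain ⟨L, hL⟩ := exists_linearMap_natCast_pos
    (φ '' (F.filter fun x => 0 < φ x : Finset ℝ)) ((Finset.finite_toSet _).image _) (by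
      rintro _ ⟨x, hx, rfl⟩
      exact (Finset.mem_filter.1 hx).2)
  have hLpos : ∀ x ∈ F.filter (fun x => 0 < φ x), (0 : ℝ) < (L (φ x) : ℝ) := by
    intro x hx
    obtain ⟨n, h, h'⟩ := hL (φ x) ⟨x, hx, rfl⟩
    rw [h']
    exact_mod_cast h
  -- The least ratio `t` is the largest multiple of `L ∘ φ` that can be subtracted from `φ` while
  -- staying nonnegative on `F`. The difference `ψ` vanishes at the minimiser `m`, so fewer elements
  -- of `F` have a positive value.
  obtain ⟨m, hm, hmin⟩ := Finset.exists_min_image _ (fun x => φ x / (L (φ x) : ℝ)) hne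
  have hm0 := (Finset.mem_filter.1 hm).2
  have hLm := hLpos m hm
  let t := φ m / (L (φ m) : ℝ)
  have ht : 0 < t := div_pos hm0 hLm
  let Lr : ℝ →ₗ[ℚ] ℝ := (Algebra.linearMap ℚ ℝ).comp (L.comp φ)
  have hLr : ∀ x, Lr x = (L (φ x) : ℝ) := fun x => rfl
  let ψ : ℝ →ₗ[ℚ] ℝ := φ - (LinearMap.mulLeft ℚ t).comp Lr
  have hψ : ∀ x, ψ x = φ x - t * (L (φ x) : ℝ) := fun x => rfl
  have hzero : ∀ x ∈ F, ¬ 0 < φ x → φ x = 0 := fun x hx h => le_antisymm (not_lt.1 h) (hφ x hx)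
  have hψ0 : ∀ x ∈ F, 0 ≤ ψ x := by
    intro x hx
    rw [hψ]
    by_cases h : 0 < φ x
    · have hx' : x ∈ F.filter fun x => 0 < φ x := by simp [hx, h]
      have := hmin x hx'
      rw [le_div_iff₀ (hLpos x hx')] at this
      linarith
    · simp [hzero x hx h]
  obtain ⟨K, hK, hsum⟩ := ih (F.filter fun x => 0 < ψ x).card (by
    rw [← hn]
    refine Finset.card_lt_card ((Finset.ssubset_iff_of_subset ?_).2 ⟨m, hm, ?_⟩)
    · intro x hx
      simp only [Finset.mem_filter] at hx ⊢
      refine ⟨hx.1, ?_⟩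
      by_contra h
      have := hx.2
      simp [hψ, hzero x hx.1 h] at this
    · simp only [Finset.mem_filter, not_and, hψ, t]
      intro _
      rw [div_mul_cancel₀ _ hLm.ne']
      simp) ψ hψ0 rfl
  refine ⟨(t, L.comp φ) :: K, ?_, ?_⟩
  · intro p hp
    rcases List.mem_cons.1 hp with rfl | hp
    · refine ⟨ht, fun x hx => ?_⟩
      by_cases h : 0 < φ x
      · obtain ⟨n, -, h'⟩ := hL (φ x) ⟨x, by simp [hx, h], rfl⟩
        exact ⟨n, h'⟩
      · exact ⟨0, by simp [hzero x hx h]⟩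
    · exact hK p hp
  · intro x hx
    rw [List.map_cons, List.sum_cons, ← hsum x hx, hψ]
    simp

end RectExchange

namespace RectExchange
open Set

/-! ### Tilings of the line adapted to a finite set -/

/-- `s₀` is the minimum of `S` and `L` lists the successive gaps. That the total sum lands in `S` is
carried along so that, when a new maximum is inserted, the appended gap is positive. -/
theorem exists_gaps (S : Finset ℝ) : ∃ (s₀ : ℝ) (L : List ℝ), (∀ e ∈ L, 0 < e) ∧
    (S.Nonempty → s₀ + L.sum ∈ S) ∧ ∀ a ∈ S, ∃ L₁ L₂, L = L₁ ++ L₂ ∧ a = s₀ + L₁.sum := by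
  classical
  induction S using Finset.induction_on_max with
  | empty => exact ⟨0, [], by simp, by simp, by simp⟩
  | insert m S hm ih =>
    rcases S.eq_empty_or_nonempty with rfl | hS
    · refine ⟨m, [], by simp, by simp, fun a ha => ⟨[], [], rfl, by simpa using ha⟩⟩
    obtain ⟨s₀, L, hL, hlast, h⟩ := ih
    have hlt := hm _ (hlast hS)
    refine ⟨s₀, L ++ [m - (s₀ + L.sum)], ?_, fun _ => by
      refine Finset.mem_insert.2 (Or.inl ?_)
      rw [List.sum_append, List.sum_singleton]
      ring, fun a ha => ?_⟩
    · intro e he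
      rcases List.mem_append.1 he with he | he
      · exact hL e he
      · rw [List.mem_singleton.1 he]
        linarith
    · rcases Finset.mem_insert.1 ha with rfl | ha
      · exact ⟨_, [], (List.append_nil _).symm, by
          rw [List.sum_append, List.sum_singleton]
          ring⟩
      · obtain ⟨L₁, L₂, rfl, rfl⟩ := h a ha
        exact ⟨L₁, L₂ ++ _, List.append_assoc _ _ _, rfl⟩

/-- Two prefixes of one list are comparable, and positivity of the entries lets the sums decide
which is the shorter. -/
theorem exists_middle {L L₁ L₂ L₁' L₂' : List ℝ} (hL : ∀ e ∈ L, 0 < e) (h : L = L₁ ++ L₂)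
    (h' : L = L₁' ++ L₂') (hle : L₁.sum ≤ L₁'.sum) : ∃ C, L₁' = L₁ ++ C := by
  rcases List.append_eq_append_iff.1 (h.symm.trans h') with ⟨C, hC, -⟩ | ⟨C, hC, -⟩
  · exact ⟨C, hC⟩
  · refine ⟨[], ?_⟩
    cases C with
    | nil => simp [hC]
    | cons e C =>
      exfalso
      have hpos : ∀ x ∈ e :: C, 0 < x := fun x hx => hL x (by
        rw [h, hC]
        simp only [List.mem_append]
        exact Or.inl (Or.inr hx))
      have := List.sum_pos (e :: C) hpos (by simp)
      rw [hC, List.sum_append] at hle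
      linarith

/-- A word of positive lengths for every gap, such that the number of occurrences of a given length
is additive. -/
theorem exists_words (F : Finset ℝ) (hF : ∀ x ∈ F, 0 < x) :
    ∃ w : ℝ → List ℝ, (∀ x ∈ F, (∀ e ∈ w x, 0 < e) ∧ (w x).sum = x) ∧
      ∀ L L' : List ℝ, (∀ x ∈ L, x ∈ F) → (∀ x ∈ L', x ∈ F) → L.sum = L'.sum →
        (L.flatMap w).Perm (L'.flatMap w) := by
  classical
  -- The form decomposed is the identity of `ℝ`; the general statement was needed only for the
  -- induction.
  obtain ⟨K, hK, hsum⟩ := exists_decomposition F (Algebra.linearMap ℝ ℝ |>.restrictScalars ℚ)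
    (fun x hx => (hF x hx).le)
  have hcast : ∀ p ∈ K, ∀ x ∈ F, ((⌊p.2 x⌋₊ : ℕ) : ℚ) = p.2 x := by
    intro p hp x hx
    obtain ⟨n, hn⟩ := (hK p hp).2 x hx
    rw [hn, Nat.floor_natCast]
  refine ⟨fun x => K.flatMap fun p => List.replicate ⌊p.2 x⌋₊ p.1, fun x hx => ⟨?_, ?_⟩, ?_⟩
  · intro e he
    obtain ⟨p, hp, he⟩ := List.mem_flatMap.1 he
    rw [(List.mem_replicate.1 he).2]
    exact (hK p hp).1
  · have h := hsum x hx
    simp only [List.flatMap_def, List.sum_flatten, List.map_map]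
    refine Eq.trans ?_ h.symm
    congr 1
    refine List.map_congr_left fun p hp => ?_
    rw [Function.comp_apply, List.sum_replicate, nsmul_eq_mul, mul_comm]
    congr 1
    exact_mod_cast hcast p hp x hx
  · intro L L' hL hL' hLL'
    rw [List.perm_iff_count]
    intro e
    -- The number of tiles of length `e` is the value at `L.sum` of a `ℚ`-linear form, the sum of
    -- the `p.2` with `p.1 = e`. It therefore depends on the list only through its sum.
    have key : ∀ L : List ℝ, (∀ x ∈ L, x ∈ F) →
        ((List.count e (L.flatMap fun x => K.flatMap fun p => List.replicate ⌊p.2 x⌋₊ p.1) : ℕ) : ℚ)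
          = (K.map fun p => if p.1 = e then p.2 L.sum else 0).sum := by
      intro L hL
      induction L with
      | nil => simp
      | cons x L ih =>
        rw [List.flatMap_cons, List.count_append, Nat.cast_add,
          ih fun y hy => hL y (List.mem_cons_of_mem _ hy), List.count_flatMap, Nat.cast_list_sum,
          List.map_map, ← List.sum_map_add]
        congr 1
        refine List.map_congr_left fun p hp => ?_
        simp only [Function.comp_apply, List.count_replicate, beq_iff_eq]
        split_ifs with h
        · rw [hcast p hp x (hL x (by simp)), List.sum_cons, map_add]
        · simp
    have h := key L hL
    rw [hLL', ← key L' hL'] at h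
    exact_mod_cast h

/-- A finite set `S` of reals has a tiling of its hull by finitely many intervals such that
intervals of equal length with endpoints in `S` are tiled in the same way up to order. -/
theorem exists_tiling (S : Finset ℝ) : ∃ T : ℝ → ℝ → Prop,
    {p : ℝ × ℝ | T p.1 p.2}.Finite ∧ (∀ s l, T s l → 0 < l) ∧
    (∀ s l s' l' t, T s l → T s' l' → t ∈ Ico s (s + l) → t ∈ Ico s' (s' + l') →
      s = s' ∧ l = l') ∧
    (∀ a ∈ S, ∀ b ∈ S, ∀ t ∈ Ico a b, ∃ s l, T s l ∧ a ≤ s ∧ s + l ≤ b ∧ t ∈ Ico s (s + l)) ∧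
    ∀ a ∈ S, ∀ b ∈ S, ∀ a' ∈ S, ∀ b' ∈ S, b - a = b' - a' → ∃ σ ∈ iet a' b',
      ∀ s l, T s l → a ≤ s → s + l ≤ b → ∃ s', T s' l ∧ a' ≤ s' ∧ s' + l ≤ b' ∧
        ∀ t ∈ Ico s (s + l), σ (t + (a' - a)) = t + (s' - s) := by
  classical
  obtain ⟨s₀, L, hL, -, hS⟩ := exists_gaps S
  obtain ⟨w, hw, hperm⟩ := exists_words L.toFinset (fun x hx => hL x (by simpa using hx))
  have hwpos : ∀ e ∈ L.flatMap w, 0 < e := by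
    intro e he
    obtain ⟨x, hx, he⟩ := List.mem_flatMap.1 he
    exact (hw x (by simpa using hx)).1 e he
  have hwsum : ∀ C : List ℝ, (∀ x ∈ C, x ∈ L) → (C.flatMap w).sum = C.sum := by
    intro C hC
    induction C with
    | nil => rfl
    | cons x C ih =>
      rw [List.flatMap_cons, List.sum_append, List.sum_cons,
        ih fun y hy => hC y (List.mem_cons_of_mem _ hy), (hw x (by simpa using hC x (by simp))).2]
  have hsub : ∀ a ∈ S, ∀ b ∈ S, a ≤ b → ∃ C : List ℝ, (∀ x ∈ C, x ∈ L) ∧ b = a + C.sum ∧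
      ∀ s l, IsTile a (C.flatMap w) s l ↔ IsTile s₀ (L.flatMap w) s l ∧ a ≤ s ∧ s + l ≤ b := by
    intro a ha b hb hab
    obtain ⟨L₁, L₂, h₁, rfl⟩ := hS a ha
    obtain ⟨L₁', L₂', h₂, rfl⟩ := hS b hb
    obtain ⟨C, rfl⟩ := exists_middle hL h₁ h₂ (by linarith)
    have hm1 : ∀ x ∈ L₁, x ∈ L := fun x hx => by simp [h₂, hx]
    have hmC : ∀ x ∈ C, x ∈ L := fun x hx => by simp [h₂, hx]
    have hm2 : ∀ x ∈ L₂', x ∈ L := fun x hx => by simp [h₂, hx]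
    have hp : ∀ D : List ℝ, (∀ x ∈ D, x ∈ L) → ∀ e ∈ D.flatMap w, 0 < e := by
      intro D hD e he
      obtain ⟨x, hx, he⟩ := List.mem_flatMap.1 he
      exact hwpos e (List.mem_flatMap.2 ⟨x, hD x hx, he⟩)
    have hn : ∀ D : List ℝ, (∀ x ∈ D, x ∈ L) → ∀ e ∈ D.flatMap w, 0 ≤ e :=
      fun D hD e he => (hp D hD e he).le
    refine ⟨C, hmC, by rw [List.sum_append]; ring, fun s l => ?_⟩
    rw [show L.flatMap w = (L₁.flatMap w ++ C.flatMap w) ++ L₂'.flatMap w by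
      rw [h₂, List.flatMap_append, List.flatMap_append], isTile_append, isTile_append,
      List.sum_append, hwsum _ hm1, hwsum _ hmC, List.sum_append]
    constructor
    · intro h
      have := h.le (hn C hmC)
      rw [hwsum _ hmC] at this
      exact ⟨Or.inl (Or.inr h), this.1, by linarith⟩
    -- A tile from the part before `a` or after `b` cannot lie in `[a, b)` because its length is
    -- positive.
    · rintro ⟨(h | h) | h, h3, h4⟩
      · have h5 := h.le (hn L₁ hm1)
        have := hp L₁ hm1 _ h.mem
        rw [hwsum _ hm1] at h5
        linarith
      · exact h
      · have h5 := h.le (hn L₂' hm2)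
        have := hp L₂' hm2 _ h.mem
        linarith
  refine ⟨IsTile s₀ (L.flatMap w), finite_isTile _ _, fun s l h => hwpos l h.mem, ?_, ?_, ?_⟩
  · intro s l s' l' t h h' ht ht'
    exact h.eq_of_mem h' (fun e he => (hwpos e he).le) ht ht'
  · intro a ha b hb t ht
    obtain ⟨C, hC, rfl, hiff⟩ := hsub a ha b hb (ht.1.trans ht.2.le)
    obtain ⟨s, l, h, h'⟩ := exists_isTile (w := C.flatMap w) (a := a) (t := t)
      (by rwa [hwsum C hC])
    obtain ⟨h1, h2, h3⟩ := (hiff s l).1 h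
    exact ⟨s, l, h1, h2, h3, h'⟩
  · intro a ha b hb a' ha' b' hb' hlen
    rcases lt_or_ge b a with hlt | hab
    -- When `b < a` no tile fits between them, so the condition is vacuous.
    · refine ⟨1, one_mem _, fun s l h h1 h2 => ?_⟩
      have := hwpos l h.mem
      linarith
    obtain ⟨C, hC, rfl, hiff⟩ := hsub a ha b hb hab
    obtain ⟨C', hC', rfl, hiff'⟩ := hsub a' ha' b' hb' (by linarith)
    have hCC' : C.sum = C'.sum := by linarith
    obtain ⟨σ, hσ, h⟩ := exists_iet_of_perm
      (hperm C C' (by simpa using hC) (by simpa using hC') hCC') (fun e he => by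
        obtain ⟨x, hx, he⟩ := List.mem_flatMap.1 he
        exact (hwpos e (List.mem_flatMap.2 ⟨x, hC x hx, he⟩)).le) a'
    rw [hwsum C hC, hCC'] at hσ
    refine ⟨σ, hσ, fun s l hs h1 h2 => ?_⟩
    have h3 := isTile_add (v := a' - a) ((hiff s l).2 ⟨hs, h1, h2⟩)
    rw [add_sub_cancel] at h3
    obtain ⟨s', hs', h4⟩ := h _ l h3
    obtain ⟨h5, h6, h7⟩ := (hiff' s' l).1 hs'
    refine ⟨s', h5, h6, h7, fun t ht => ?_⟩
    rw [h4 _ ⟨by linarith [ht.1], by linarith [ht.2]⟩]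
    ring

end RectExchange

namespace RectExchange
open Set

/-! ### Shuffles of the ambient space -/

open Classical in
/-- Apply `σ` to the `i`-th coordinate at the points whose other coordinates lie in the box. -/
noncomputable def slabMap {d : ℕ} (i : Fin d) (a b : Fin d → ℝ) (σ : Equiv.Perm ℝ)
    (x : Fin d → ℝ) : Fin d → ℝ :=
  if ∀ j, j ≠ i → x j ∈ Ico (a j) (b j) then Function.update x i (σ (x i)) else x

theorem slabMap_slabMap {d : ℕ} (i : Fin d) (a b : Fin d → ℝ) (σ τ : Equiv.Perm ℝ)
    (x : Fin d → ℝ) : slabMap i a b σ (slabMap i a b τ x) = slabMap i a b (σ * τ) x := by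
  unfold slabMap
  by_cases h : ∀ j, j ≠ i → x j ∈ Ico (a j) (b j)
  · have h' : ∀ j, j ≠ i → Function.update x i (τ (x i)) j ∈ Ico (a j) (b j) := by
      intro j hj
      rw [Function.update_of_ne hj]
      exact h j hj
    rw [if_pos h, if_pos h', if_pos h]
    simp
  · rw [if_neg h, if_neg h, if_neg h]

theorem slabMap_one {d : ℕ} (i : Fin d) (a b x : Fin d → ℝ) : slabMap i a b 1 x = x := by
  simp [slabMap]

/-- The action of permutations of the line on a slab. -/
noncomputable def slab {d : ℕ} (i : Fin d) (a b : Fin d → ℝ) :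
    Equiv.Perm ℝ →* Equiv.Perm (Fin d → ℝ) where
  toFun σ :=
    { toFun := slabMap i a b σ
      invFun := slabMap i a b σ⁻¹
      left_inv := fun x => by rw [slabMap_slabMap, inv_mul_cancel, slabMap_one]
      right_inv := fun x => by rw [slabMap_slabMap, mul_inv_cancel, slabMap_one] }
  map_one' := Equiv.ext fun x => slabMap_one i a b x
  map_mul' σ τ := Equiv.ext fun x => (slabMap_slabMap i a b σ τ x).symm

theorem slab_apply {d : ℕ} (i : Fin d) (a b : Fin d → ℝ) (σ : Equiv.Perm ℝ) (x : Fin d → ℝ) :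
    slab i a b σ x = slabMap i a b σ x := rfl

/-- The group of permutations of the ambient space generated by the shuffles of boxes in `M`. -/
def shuffleGroup {d : ℕ} (M : Set (Fin d → ℝ)) : Subgroup (Equiv.Perm (Fin d → ℝ)) :=
  Subgroup.closure {g | ∃ (i : Fin d) (a b : Fin d → ℝ) (c : ℝ), a i ≤ c ∧ c ≤ b i ∧
    box a b ⊆ M ∧ ∀ x, ((∀ j, j ≠ i → x j ∈ Ico (a j) (b j)) →
        g x = Function.update x i (restrictedRotation (a i) c (b i) (x i))) ∧
      ((¬ ∀ j, j ≠ i → x j ∈ Ico (a j) (b j)) → g x = x)}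

/-- As `slab` is a homomorphism, generators suffice. A rotation inside `[u, v)` is a shuffle of the
box shrunk to `[u, v)` in direction `i`, which still lies in `M`. -/
theorem slab_mem_shuffleGroup {d : ℕ} {M : Set (Fin d → ℝ)} {i : Fin d} {a b : Fin d → ℝ}
    (h : box a b ⊆ M) {σ : Equiv.Perm ℝ} (hσ : σ ∈ iet (a i) (b i)) :
    slab i a b σ ∈ shuffleGroup M := by
  suffices iet (a i) (b i) ≤ (shuffleGroup M).comap (slab i a b) from this hσ
  refine (Subgroup.closure_le _).2 ?_
  rintro σ ⟨u, c, v, h₁, h₂, h₃, h₄, hσ⟩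
  refine Subgroup.subset_closure ⟨i, Function.update a i u, Function.update b i v, c, by simpa,
    by simpa, ?_, fun x => ?_⟩
  · refine Subset.trans (fun x hx => ?_) h
    rw [mem_box] at hx ⊢
    intro j
    have := hx j
    rcases eq_or_ne j i with rfl | hj
    · simp only [Function.update_self] at this
      exact ⟨h₁.trans this.1, this.2.trans_le h₄⟩
    · simpa only [Function.update_of_ne hj] using this
  · have hiff : (∀ j, j ≠ i → x j ∈ Ico (Function.update a i u j) (Function.update b i v j)) ↔
        ∀ j, j ≠ i → x j ∈ Ico (a j) (b j) := by
      refine forall_congr' fun j => imp_congr_right fun hj => ?_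
      rw [Function.update_of_ne hj, Function.update_of_ne hj]
    rw [hiff, slab_apply, slabMap, Function.update_self, Function.update_self]
    exact ⟨fun hx => by rw [if_pos hx, hσ], fun hx => by rw [if_neg hx]⟩

/-- Permutations in a group with disjoint supports can be glued. -/
theorem exists_glue {ι E : Type*} (G : Subgroup (Equiv.Perm E)) (J : Finset ι) (U : ι → Set E)
    (hU : (J : Set ι).PairwiseDisjoint U) (g : ι → Equiv.Perm E) (hg : ∀ k ∈ J, g k ∈ G)
    (hfix : ∀ k ∈ J, ∀ z, z ∉ U k → g k z = z) :
    ∃ h ∈ G, (∀ k ∈ J, ∀ z ∈ U k, h z = g k z) ∧ ∀ z, (∀ k ∈ J, z ∉ U k) → h z = z := by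
  classical
  induction J using Finset.induction_on with
  | empty => exact ⟨1, one_mem _, by simp, by simp⟩
  | insert k J hk ih =>
    obtain ⟨h, hG, h₁, h₂⟩ := ih (hU.subset (by simp)) (fun j hj => hg j (by simp [hj]))
      (fun j hj => hfix j (by simp [hj]))
    refine ⟨g k * h, mul_mem (hg k (by simp)) hG, fun j hj z hz => ?_, fun z hz => ?_⟩
    · have hd : ∀ j' ∈ insert k J, j' ≠ j → ∀ z ∈ U j, z ∉ U j' := fun j' hj' hne z hz hz' =>
        disjoint_left.1 (hU (by simpa using hj') (by simpa using hj) hne) hz' hz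
      rw [Equiv.Perm.mul_apply]
      rcases Finset.mem_insert.1 hj with rfl | hj'
      · rw [h₂ z fun j' hj' => hd j' (by simp [hj']) (fun e => hk (e ▸ hj')) z hz]
      · rw [h₁ j hj' z hz]
        refine hfix k (by simp) _ (hd k (by simp) (fun e => hk (e ▸ hj')) _ ?_)
        -- `g j` fixes every point outside `U j`, so by injectivity it maps `U j` into itself.
        by_contra hn
        have := hfix j hj _ hn
        exact hn (by rwa [(g j).injective this])
    · rw [Equiv.Perm.mul_apply, h₂ z fun j hj => hz j (by simp [hj]), hfix k (by simp) z
        (hz k (by simp))]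

/-! ### Swaps of translates of a box -/

open Classical in
/-- The permutation exchanging the boxes of side lengths `δ` at `x` and at `y` by translations is
generated by shuffles of `M`. -/
def BoxSwap {d : ℕ} (M : Set (Fin d → ℝ)) (δ x y : Fin d → ℝ) : Prop :=
  ∃ g ∈ shuffleGroup M, ∀ z, g z = if z ∈ box x (x + δ) then z + (y - x) else
    if z ∈ box y (y + δ) then z + (x - y) else z

/-- The boxes of side lengths `δ` at `x` and at `y` are equal or disjoint. -/
def Separated {d : ℕ} (δ x y : Fin d → ℝ) : Prop :=
  x = y ∨ Disjoint (box x (x + δ)) (box y (y + δ))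

theorem Separated.symm {d : ℕ} {δ x y : Fin d → ℝ} (h : Separated δ x y) : Separated δ y x :=
  h.imp Eq.symm fun h => h.symm

theorem separated_of_coord {d : ℕ} {δ x y : Fin d → ℝ}
    (h : ∀ i, x i = y i ∨ δ i ≤ |x i - y i|) : Separated δ x y := by
  by_cases hxy : x = y
  · exact Or.inl hxy
  obtain ⟨i, hi⟩ := Function.ne_iff.1 hxy
  refine Or.inr (disjoint_left.2 fun z hz hz' => ?_)
  have h1 := mem_box.1 hz i
  have h2 := mem_box.1 hz' i
  simp only [Pi.add_apply] at h1 h2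
  have h3 := (h i).resolve_left hi
  rcases le_abs.1 h3 with h3 | h3 <;> linarith

theorem add_mem_box {d : ℕ} {δ x z : Fin d → ℝ} (y : Fin d → ℝ) (hz : z ∈ box x (x + δ)) :
    z + (y - x) ∈ box y (y + δ) := by
  rw [mem_box] at hz ⊢
  intro i
  have := hz i
  simp only [Pi.add_apply, Pi.sub_apply] at this ⊢
  constructor <;> linarith

theorem BoxSwap.refl {d : ℕ} (M : Set (Fin d → ℝ)) (δ x : Fin d → ℝ) : BoxSwap M δ x x :=
  ⟨1, one_mem _, fun z => by simp⟩

theorem BoxSwap.symm {d : ℕ} {M : Set (Fin d → ℝ)} {δ x y : Fin d → ℝ} (h : BoxSwap M δ x y)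
    (hs : Separated δ x y) : BoxSwap M δ y x := by
  rcases hs with rfl | hs
  · exact h
  obtain ⟨g, hg, h⟩ := h
  refine ⟨g, hg, fun z => ?_⟩
  rw [h]
  have : z ∈ box x (x + δ) → z ∉ box y (y + δ) := fun h => disjoint_left.1 hs h
  split_ifs <;> tauto

/-- This is the identity `(x y)(y z)(x y) = (x z)` for transpositions. It needs the three boxes
pairwise disjoint; the cases of equal boxes are trivial. -/
theorem BoxSwap.trans {d : ℕ} {M : Set (Fin d → ℝ)} {δ x y z : Fin d → ℝ} (h : BoxSwap M δ x y)
    (h' : BoxSwap M δ y z) (hxy : Separated δ x y) (hyz : Separated δ y z)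
    (hxz : Separated δ x z) : BoxSwap M δ x z := by
  rcases hxy with rfl | hxy
  · exact h'
  rcases hyz with rfl | hyz
  · exact h
  rcases hxz with rfl | hxz
  · exact BoxSwap.refl M δ x
  obtain ⟨g, hg, h⟩ := h
  obtain ⟨g', hg', h'⟩ := h'
  rw [disjoint_left] at hxy hyz hxz
  refine ⟨g * g' * g, mul_mem (mul_mem hg hg') hg, fun w => ?_⟩
  rw [Equiv.Perm.mul_apply, Equiv.Perm.mul_apply]
  by_cases hx : w ∈ box x (x + δ)
  · have h1 := add_mem_box y hx
    have h2 := add_mem_box z hx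
    rw [if_pos hx, h w, if_pos hx, h', if_pos h1,
      show w + (y - x) + (z - y) = w + (z - x) by abel, h, if_neg fun h3 => hxz h3 h2,
      if_neg fun h3 => hyz h3 h2]
  rw [if_neg hx]
  by_cases hy : w ∈ box y (y + δ)
  · have h1 := add_mem_box x hy
    rw [h w, if_neg hx, if_pos hy, h', if_neg (hxy h1), if_neg (hxz h1), h, if_pos h1,
      if_neg (hyz hy)]
    abel
  by_cases hz : w ∈ box z (z + δ)
  · have h1 := add_mem_box y hz
    rw [h w, if_neg hx, if_neg hy, h', if_neg hy, if_pos hz, if_pos hz, h,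
      if_neg fun h3 => hxy h3 h1, if_pos h1]
    abel
  · rw [h w, if_neg hx, if_neg hy, h', if_neg hy, if_neg hz, h, if_neg hx, if_neg hy, if_neg hz]

/-- The boxes differ only by a displacement along axis `i`, so the swap is the one-dimensional swap
of two intervals applied in the slab over `box x (y + δ)`, which contains both boxes. -/
theorem boxSwap_of_eq_off {d : ℕ} {M : Set (Fin d → ℝ)} {δ x y : Fin d → ℝ} (i : Fin d)
    (hδ : ∀ j, 0 < δ j) (hxy : ∀ j, j ≠ i → y j = x j) (hi : x i + δ i ≤ y i)
    (hM : box x (y + δ) ⊆ M) : BoxSwap M δ x y := by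
  obtain ⟨σ, hσ, h⟩ := exists_iet_swap (u := x i) (t := y i - x i) (hδ i).le (by linarith)
  rw [show x i + (y i - x i) + δ i = (y + δ) i by simp] at hσ
  refine ⟨_, slab_mem_shuffleGroup hM hσ, fun z => ?_⟩
  rw [slab_apply, slabMap]
  by_cases hz : ∀ j, j ≠ i → z j ∈ Ico (x j) ((y + δ) j)
  · have hx : z ∈ box x (x + δ) ↔ z i ∈ Ico (x i) (x i + δ i) := by
      rw [mem_box]
      refine ⟨fun h => h i, fun h j => ?_⟩
      rcases eq_or_ne j i with rfl | hj
      · exact h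
      · have := hz j hj
        rwa [Pi.add_apply, hxy j hj] at this
    have hy : z ∈ box y (y + δ) ↔ z i - (y i - x i) ∈ Ico (x i) (x i + δ i) := by
      rw [mem_box]
      refine ⟨fun h => ?_, fun h j => ?_⟩
      · have := h i
        rw [Pi.add_apply] at this
        constructor <;> linarith
      rcases eq_or_ne j i with rfl | hj
      · rw [Pi.add_apply]
        constructor <;> linarith [h.1, h.2]
      · have := hz j hj
        rwa [hxy j hj]
    have hupd : ∀ r : ℝ, Function.update z i (z i + r) = z + Pi.single i r := by
      intro r
      ext j
      rcases eq_or_ne j i with rfl | hj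
      · simp
      · simp [hj]
    have hsub : y - x = Pi.single i (y i - x i) := by
      ext j
      rcases eq_or_ne j i with rfl | hj
      · simp
      · simp [hj, hxy j hj]
    have hsub' : x - y = Pi.single i (x i - y i) := by
      ext j
      rcases eq_or_ne j i with rfl | hj
      · simp
      · simp [hj, hxy j hj]
    rw [if_pos hz, h]
    simp only [hx, hy]
    split_ifs
    · rw [hupd, hsub]
    · rw [sub_eq_add_neg, neg_sub, hupd, hsub']
    · exact Function.update_eq_self _ _
  · rw [if_neg hz, if_neg, if_neg]
    · intro h
      exact hz fun j hj => by
        have := mem_box.1 h j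
        rwa [hxy j hj] at this
    · intro h
      exact hz fun j hj => by
        have := mem_box.1 h j
        rwa [Pi.add_apply, ← hxy j hj, ← Pi.add_apply, hxy j hj] at this

/-- Two translates of a box inside a rectangle of `M` can be swapped, if their sides are pairwise
equal or disjoint. -/
theorem boxSwap_of_coord {d : ℕ} {M : Set (Fin d → ℝ)} {δ x y p q : Fin d → ℝ}
    (hδ : ∀ j, 0 < δ j) (hM : box p q ⊆ M) (hx : ∀ i, p i ≤ x i ∧ x i + δ i ≤ q i)
    (hy : ∀ i, p i ≤ y i ∧ y i + δ i ≤ q i) (h : ∀ i, x i = y i ∨ δ i ≤ |x i - y i|) :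
    BoxSwap M δ x y := by
  classical
  -- The coordinates of `x` are replaced by those of `y` one at a time. Every intermediate box stays
  -- in `box p q` and is equal to or disjoint from the others in play.
  have key : ∀ J : Finset (Fin d), BoxSwap M δ x (J.piecewise y x) := by
    intro J
    induction J using Finset.induction_on with
    | empty =>
      rw [Finset.piecewise_empty]
      exact BoxSwap.refl M δ x
    | insert i J hi ih =>
      have hJ : ∀ j, j ∉ J → J.piecewise y x j = x j := fun j hj =>
        Finset.piecewise_eq_of_notMem _ _ _ hj
      have hJ' : ∀ j, j ∈ J → J.piecewise y x j = y j := fun j hj =>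
        Finset.piecewise_eq_of_mem _ _ _ hj
      rw [Finset.piecewise_insert]
      set z := J.piecewise y x with hz
      have hpq : ∀ j, p j ≤ z j ∧ z j + δ j ≤ q j := by
        intro j
        by_cases hj : j ∈ J
        · rw [hJ' j hj]
          exact hy j
        · rw [hJ j hj]
          exact hx j
      have hzi := hJ i hi
      have hsep1 : Separated δ x z := separated_of_coord fun j => by
        by_cases hj : j ∈ J
        · rw [hJ' j hj]
          exact h j
        · exact Or.inl (hJ j hj).symm
      have hc : ∀ j, z j = Function.update z i (y i) j ∨
          δ j ≤ |z j - Function.update z i (y i) j| := by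
        intro j
        rcases eq_or_ne j i with rfl | hj
        · rw [Function.update_self, hzi]
          exact h j
        · exact Or.inl (Function.update_of_ne hj _ _).symm
      have hsep3 : Separated δ x (Function.update z i (y i)) := separated_of_coord fun j => by
        rcases eq_or_ne j i with rfl | hj
        · rw [Function.update_self]
          exact h j
        · rw [Function.update_of_ne hj]
          by_cases hj : j ∈ J
          · rw [hJ' j hj]
            exact h j
          · exact Or.inl (hJ j hj).symm
      refine ih.trans ?_ hsep1 (separated_of_coord hc) hsep3
      rcases h i with hi' | hi'
      · rw [← hi', ← hzi, Function.update_eq_self]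
        exact BoxSwap.refl M δ z
      rcases le_abs.1 hi' with hi' | hi'
      · refine BoxSwap.symm (boxSwap_of_eq_off i hδ (fun j hj => ?_) ?_ ?_)
          (separated_of_coord hc).symm
        · rw [Function.update_of_ne hj]
        · rw [Function.update_self, hzi]
          linarith
        · refine Subset.trans (fun w hw => mem_box.2 fun j => ?_) hM
          have h1 := mem_box.1 hw j
          refine ⟨le_trans ?_ h1.1, h1.2.trans_le (hpq j).2⟩
          rcases eq_or_ne j i with rfl | hj
          · rw [Function.update_self]
            exact (hy j).1
          · rw [Function.update_of_ne hj]
            exact (hpq j).1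
      · refine boxSwap_of_eq_off i hδ (fun j hj => ?_) ?_ ?_
        · rw [Function.update_of_ne hj]
        · rw [Function.update_self, hzi]
          linarith
        · refine Subset.trans (fun w hw => mem_box.2 fun j => ?_) hM
          have h1 := mem_box.1 hw j
          refine ⟨(hpq j).1.trans h1.1, h1.2.trans_le ?_⟩
          rw [Pi.add_apply]
          rcases eq_or_ne j i with rfl | hj
          · rw [Function.update_self]
            exact (hy j).2
          · rw [Function.update_of_ne hj]
            exact (hpq j).2
  have := key Finset.univ
  rwa [Finset.piecewise_univ] at this

end RectExchange

namespace RectExchange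
open Set Filter Topology

/-! ### Swaps in a connected multirectangle -/

/-- All sufficiently small boxes, of shape `δ` up to scaling, at `x` and `y` can be swapped. -/
def SmallSwap {d : ℕ} (M : Set (Fin d → ℝ)) (δ x y : Fin d → ℝ) : Prop :=
  ∀ᶠ t in 𝓝[>] (0 : ℝ), BoxSwap M (t • δ) x y

theorem eventually_mul_le {δ r : ℝ} (hr : 0 < r) : ∀ᶠ t in 𝓝[>] (0 : ℝ), t * δ ≤ r := by
  have h : Tendsto (fun t : ℝ => t * δ) (𝓝[>] 0) (𝓝 (0 * δ)) :=
    (continuous_id.mul continuous_const).continuousWithinAt.tendsto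
  rw [zero_mul] at h
  filter_upwards [h.eventually (gt_mem_nhds hr)] with t ht using ht.le

theorem eventually_coord {d : ℕ} (δ x y : Fin d → ℝ) :
    ∀ᶠ t in 𝓝[>] (0 : ℝ), ∀ i, x i = y i ∨ (t • δ) i ≤ |x i - y i| := by
  refine eventually_all.2 fun i => ?_
  by_cases h : x i = y i
  · exact Eventually.of_forall fun t => Or.inl h
  · filter_upwards [eventually_mul_le (δ := δ i) (abs_pos.2 (sub_ne_zero.2 h))] with t ht
    exact Or.inr ht

theorem SmallSwap.symm {d : ℕ} {M : Set (Fin d → ℝ)} {δ x y : Fin d → ℝ}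
    (h : SmallSwap M δ x y) : SmallSwap M δ y x := by
  filter_upwards [h, eventually_coord δ x y] with t ht hc
  exact ht.symm (separated_of_coord hc)

theorem SmallSwap.trans {d : ℕ} {M : Set (Fin d → ℝ)} {δ x y z : Fin d → ℝ}
    (h : SmallSwap M δ x y) (h' : SmallSwap M δ y z) : SmallSwap M δ x z := by
  filter_upwards [h, h', eventually_coord δ x y, eventually_coord δ y z, eventually_coord δ x z]
    with t h1 h2 h3 h4 h5
  exact h1.trans h2 (separated_of_coord h3) (separated_of_coord h4) (separated_of_coord h5)

theorem smallSwap_of_mem_box {d : ℕ} {M : Set (Fin d → ℝ)} {δ x y p q : Fin d → ℝ}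
    (hδ : ∀ i, 0 < δ i) (hM : box p q ⊆ M) (hx : x ∈ box p q) (hy : y ∈ box p q) :
    SmallSwap M δ x y := by
  rw [mem_box] at hx hy
  have h1 : ∀ᶠ t in 𝓝[>] (0 : ℝ), ∀ i, t * δ i ≤ q i - x i :=
    eventually_all.2 fun i => eventually_mul_le (sub_pos.2 (hx i).2)
  have h2 : ∀ᶠ t in 𝓝[>] (0 : ℝ), ∀ i, t * δ i ≤ q i - y i :=
    eventually_all.2 fun i => eventually_mul_le (sub_pos.2 (hy i).2)
  filter_upwards [h1, h2, eventually_coord δ x y, self_mem_nhdsWithin] with t h1 h2 h3 ht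
  refine boxSwap_of_coord (fun j => mul_pos ht (hδ j)) hM (fun i => ⟨(hx i).1, ?_⟩)
    (fun i => ⟨(hy i).1, ?_⟩) h3
  · have := h1 i
    simp only [Pi.smul_apply, smul_eq_mul]
    linarith
  · have := h2 i
    simp only [Pi.smul_apply, smul_eq_mul]
    linarith

/-- `SmallSwap` is symmetric and transitive, and it holds between a point and all nearby points
because a small cube around the point lies in `M`. Connectedness then gives all pairs. -/
theorem smallSwap_of_mem_interior {d : ℕ} {M : Set (Fin d → ℝ)} {δ : Fin d → ℝ}
    (hδ : ∀ i, 0 < δ i) (hconn : IsPreconnected (interior M)) {x y : Fin d → ℝ}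
    (hx : x ∈ interior M) (hy : y ∈ interior M) : SmallSwap M δ x y := by
  refine hconn.induction₂ (SmallSwap M δ) (fun x hx => ?_)
    (fun x y z _ _ _ h h' => h.trans h') (fun x y _ _ h => h.symm) hx hy
  obtain ⟨ε, hε, hball⟩ := Metric.isOpen_iff.1 isOpen_interior x hx
  have hbox : box (fun i => x i - ε / 2) (fun i => x i + ε / 2) ⊆ M := by
    refine Subset.trans (fun z hz => hball ?_) interior_subset
    rw [Metric.mem_ball, dist_pi_lt_iff hε]
    intro i
    have := mem_box.1 hz i
    rw [Real.dist_eq, abs_lt]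
    constructor <;> linarith
  filter_upwards [mem_nhdsWithin_of_mem_nhds (Metric.ball_mem_nhds x (half_pos hε))] with y hy
  refine smallSwap_of_mem_box hδ hbox (mem_box.2 fun i => ?_) (mem_box.2 fun i => ?_)
  · constructor <;> linarith
  · rw [Metric.mem_ball, dist_pi_lt_iff (half_pos hε)] at hy
    have := hy i
    rw [Real.dist_eq, abs_lt] at this
    constructor <;> linarith

theorem exists_mem_interior_smallSwap {d : ℕ} {M : Set (Fin d → ℝ)} (hM : IsMultirectangle M)
    {δ : Fin d → ℝ} (hδ : ∀ i, 0 < δ i) {x : Fin d → ℝ} (hx : x ∈ M) :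
    ∃ y ∈ interior M, SmallSwap M δ x y := by
  obtain ⟨𝒜, -, hrect, rfl⟩ := hM
  obtain ⟨P, hP, hxP⟩ := hx
  obtain ⟨p, q, rfl⟩ := hrect P hP
  have hsub : box p q ⊆ ⋃₀ 𝒜 := subset_sUnion_of_mem hP
  have hx := mem_box.1 hxP
  -- A point of `M` may lie on a lower face. The midpoint between it and the upper corner is
  -- interior to the same rectangle.
  refine ⟨fun i => (x i + q i) / 2, ?_, smallSwap_of_mem_box hδ hsub hxP (mem_box.2 fun i => ?_)⟩
  · refine mem_interior.2 ⟨Set.pi univ fun i => Ioo (p i) (q i),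
      (Set.pi_mono fun i _ => Ioo_subset_Ico_self).trans hsub,
      isOpen_set_pi finite_univ fun i _ => isOpen_Ioo, fun i _ => ?_⟩
    have := hx i
    constructor <;> linarith
  · have := hx i
    constructor <;> linarith

theorem smallSwap_of_mem {d : ℕ} {M : Set (Fin d → ℝ)} (hM : IsMultirectangle M)
    (hconn : IsPreconnected (interior M)) {δ : Fin d → ℝ} (hδ : ∀ i, 0 < δ i) {x y : Fin d → ℝ}
    (hx : x ∈ M) (hy : y ∈ M) : SmallSwap M δ x y := by
  obtain ⟨x', hx', h⟩ := exists_mem_interior_smallSwap hM hδ hx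
  obtain ⟨y', hy', h'⟩ := exists_mem_interior_smallSwap hM hδ hy
  exact (h.trans (smallSwap_of_mem_interior hδ hconn hx' hy')).trans h'.symm

/-- The lower corner of a box of the subdivision of the box of side lengths `N • η` at `x`. -/
def gridPoint {d : ℕ} {N : ℕ} (η x : Fin d → ℝ) (j : Fin d → Fin N) : Fin d → ℝ :=
  fun i => x i + (j i : ℕ) * η i

theorem gridPoint_coord {d : ℕ} {N : ℕ} {η x : Fin d → ℝ} (hη : ∀ i, 0 < η i)
    (j k : Fin d → Fin N) (i : Fin d) : gridPoint η x j i = gridPoint η x k i ∨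
      η i ≤ |gridPoint η x j i - gridPoint η x k i| := by
  by_cases h : j i = k i
  · left
    simp [gridPoint, h]
  · right
    have h1 : ((j i : ℕ) : ℤ) - ((k i : ℕ) : ℤ) ≠ 0 := by
      intro h2
      exact h (Fin.ext (by omega))
    have h2 := Int.one_le_abs h1
    have h3 : (1 : ℝ) ≤ |((j i : ℕ) : ℝ) - ((k i : ℕ) : ℝ)| := by exact_mod_cast h2
    rw [show gridPoint η x j i - gridPoint η x k i = (((j i : ℕ) : ℝ) - ((k i : ℕ) : ℝ)) * η i by
      simp only [gridPoint]
      ring, abs_mul, abs_of_pos (hη i)]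
    nlinarith [hη i]

theorem gridPoint_le {d : ℕ} {N : ℕ} {η x : Fin d → ℝ} (hη : ∀ i, 0 < η i)
    (j : Fin d → Fin N) (i : Fin d) :
    x i ≤ gridPoint η x j i ∧ gridPoint η x j i + η i ≤ x i + N * η i := by
  have h1 : ((j i : ℕ) : ℝ) + 1 ≤ N := by exact_mod_cast (j i).2
  have h2 : (0 : ℝ) ≤ ((j i : ℕ) : ℝ) := Nat.cast_nonneg _
  have h3 := hη i
  simp only [gridPoint]
  constructor
  · nlinarith
  · nlinarith

theorem exists_gridPoint {d : ℕ} {N : ℕ} {η x z : Fin d → ℝ} (hη : ∀ i, 0 < η i)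
    (hz : z ∈ box x (x + (N : ℝ) • η)) :
    ∃ j : Fin d → Fin N, z ∈ box (gridPoint η x j) (gridPoint η x j + η) := by
  rw [mem_box] at hz
  have h0 : ∀ i, 0 ≤ (z i - x i) / η i := fun i =>
    div_nonneg (sub_nonneg.2 (hz i).1) (hη i).le
  have h1 : ∀ i, ⌊(z i - x i) / η i⌋₊ < N := by
    intro i
    rw [Nat.floor_lt (h0 i), div_lt_iff₀ (hη i)]
    have := (hz i).2
    simp only [Pi.add_apply, Pi.smul_apply, smul_eq_mul] at this
    linarith
  refine ⟨fun i => ⟨_, h1 i⟩, mem_box.2 fun i => ?_⟩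
  have h2 := Nat.floor_le (h0 i)
  have h3 := Nat.lt_floor_add_one ((z i - x i) / η i)
  rw [le_div_iff₀ (hη i)] at h2
  rw [div_lt_iff₀ (hη i)] at h3
  simp only [gridPoint, Pi.add_apply]
  constructor <;> linarith

/-- Connectedness only swaps small boxes. Both boxes are therefore cut into `(n + 1) ^ d` cells of
sides `δ / (n + 1)`, with `n` such that the two corner cells can be swapped. Corresponding cells are
swapped in pairs, and these swaps have disjoint supports. -/
theorem boxSwap_of_connected {d : ℕ} {M : Set (Fin d → ℝ)} (hM : IsMultirectangle M)
    (hconn : IsPreconnected (interior M)) {δ x y : Fin d → ℝ} (hδ : ∀ i, 0 < δ i)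
    (hx : box x (x + δ) ⊆ M) (hy : box y (y + δ) ⊆ M)
    (hxy : Disjoint (box x (x + δ)) (box y (y + δ))) : BoxSwap M δ x y := by
  classical
  have hcorner : ∀ x : Fin d → ℝ, x ∈ box x (x + δ) := fun x => mem_box.2 fun i =>
    ⟨le_rfl, by rw [Pi.add_apply]; linarith [hδ i]⟩
  obtain ⟨n, hn⟩ := ((tendsto_nhdsWithin_iff.2
    ⟨tendsto_one_div_add_atTop_nhds_zero_nat (𝕜 := ℝ),
      Eventually.of_forall fun n => Nat.one_div_pos_of_nat⟩).eventually
    (smallSwap_of_mem hM hconn hδ (hx (hcorner x)) (hy (hcorner y)))).exists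
  set η : Fin d → ℝ := (1 / ((n : ℝ) + 1)) • δ with hηdef
  have hη : ∀ i, 0 < η i := fun i => mul_pos Nat.one_div_pos_of_nat (hδ i)
  have hηδ : δ = ((n + 1 : ℕ) : ℝ) • η := by
    rw [hηdef, smul_smul]
    push_cast
    rw [mul_one_div_cancel (by positivity), one_smul]
  have hηδ' : ∀ i, δ i = ((n + 1 : ℕ) : ℝ) * η i := fun i => congrFun hηδ i
  have hsub : ∀ (x : Fin d → ℝ) (j : Fin d → Fin (n + 1)),
      box (gridPoint η x j) (gridPoint η x j + η) ⊆ box x (x + δ) := by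
    intro x j z hz
    rw [mem_box] at hz ⊢
    intro i
    have h1 := hz i
    have h2 := gridPoint_le (x := x) hη j i
    rw [← hηδ' i] at h2
    simp only [Pi.add_apply] at h1 ⊢
    exact ⟨h2.1.trans h1.1, h1.2.trans_le h2.2⟩
  have hzero : ∀ x : Fin d → ℝ, gridPoint (N := n + 1) η x (fun _ => 0) = x := fun x => by
    ext i
    simp [gridPoint]
  have hin : ∀ x : Fin d → ℝ, box x (x + δ) ⊆ M → ∀ j k : Fin d → Fin (n + 1),
      BoxSwap M η (gridPoint η x j) (gridPoint η x k) := by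
    intro x hx j k
    refine boxSwap_of_coord hη hx (fun i => ?_) (fun i => ?_) (gridPoint_coord hη j k)
    · have := gridPoint_le (x := x) hη j i
      rwa [← hηδ' i] at this
    · have := gridPoint_le (x := x) hη k i
      rwa [← hηδ' i] at this
  have hsep : ∀ (x : Fin d → ℝ) (j k : Fin d → Fin (n + 1)),
      Separated η (gridPoint η x j) (gridPoint η x k) := fun x j k =>
    separated_of_coord (gridPoint_coord hη j k)
  have hdis : ∀ j k : Fin d → Fin (n + 1),
      Separated η (gridPoint η x j) (gridPoint η y k) := fun j k =>
    Or.inr (hxy.mono (hsub x j) (hsub y k))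
  have hswap : ∀ j : Fin d → Fin (n + 1), BoxSwap M η (gridPoint η x j) (gridPoint η y j) := by
    intro j
    have h1 : BoxSwap M η (gridPoint (N := n + 1) η x fun _ => 0)
        (gridPoint (N := n + 1) η y fun _ => 0) := by
      rw [hzero, hzero]
      exact hn
    -- Cell `j` at `x` goes to the corner cell at `x`, then to the corner cell at `y`, then to cell
    -- `j` at `y`.
    exact ((hin x hx j _).trans h1 (hsep _ _ _) (hdis _ _) (hdis _ _)).trans (hin y hy _ j)
      (hdis _ _) (hsep _ _ _) (hdis _ _)
  choose g hgG hg using hswap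
  obtain ⟨h, hG, h₁, h₂⟩ := exists_glue (shuffleGroup M) Finset.univ
    (fun j : Fin d → Fin (n + 1) => box (gridPoint η x j) (gridPoint η x j + η) ∪
      box (gridPoint η y j) (gridPoint η y j + η)) (by
        intro j _ k _ hjk
        have hne : ∀ x, gridPoint η x j ≠ gridPoint η x k := by
          intro x he
          obtain ⟨i, hi⟩ := Function.ne_iff.1 hjk
          have := congrFun he i
          simp only [gridPoint, add_right_inj, mul_eq_mul_right_iff, (hη i).ne', or_false,
            Nat.cast_inj] at this
          exact hi (Fin.ext this)
        have hd : ∀ x, Disjoint (box (gridPoint η x j) (gridPoint η x j + η))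
            (box (gridPoint η x k) (gridPoint η x k + η)) := fun x =>
          (hsep x j k).resolve_left (hne x)
        have hd' : ∀ j k, Disjoint (box (gridPoint η x j) (gridPoint η x j + η))
            (box (gridPoint η y k) (gridPoint η y k + η)) := fun j k =>
          hxy.mono (hsub x j) (hsub y k)
        exact disjoint_union_left.2 ⟨disjoint_union_right.2 ⟨hd x, hd' j k⟩,
          disjoint_union_right.2 ⟨(hd' k j).symm, hd y⟩⟩) g (fun j _ => hgG j) (by
        intro j _ z hz
        rw [mem_union, not_or] at hz
        rw [hg, if_neg hz.1, if_neg hz.2])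
  have hdiff : ∀ j : Fin d → Fin (n + 1), gridPoint η y j - gridPoint η x j = y - x := fun j => by
    ext i
    simp [gridPoint]
  have hdiff' : ∀ j : Fin d → Fin (n + 1), gridPoint η x j - gridPoint η y j = x - y := fun j => by
    ext i
    simp [gridPoint]
  refine ⟨h, hG, fun z => ?_⟩
  by_cases hzx : z ∈ box x (x + δ)
  · rw [if_pos hzx]
    rw [hηδ] at hzx
    obtain ⟨j, hj⟩ := exists_gridPoint hη hzx
    rw [h₁ j (Finset.mem_univ _) z (Or.inl hj), hg, if_pos hj, hdiff]
  rw [if_neg hzx]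
  by_cases hzy : z ∈ box y (y + δ)
  · rw [if_pos hzy]
    rw [hηδ] at hzy
    obtain ⟨j, hj⟩ := exists_gridPoint hη hzy
    rw [h₁ j (Finset.mem_univ _) z (Or.inr hj), hg, if_neg fun h => hzx (hsub x j h), if_pos hj,
      hdiff']
  rw [if_neg hzy]
  refine h₂ z fun j _ hj => ?_
  rcases hj with hj | hj
  · exact hzx (hsub x j hj)
  · exact hzy (hsub y j hj)

end RectExchange

namespace RectExchange
open Set

/-! ### Rectangle exchanges are products of shuffles -/

/-- Here `h` acts as a permutation of the finite set of cells that preserves their shape. The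
induction is on the number of cells moved, as in writing a finite permutation as a product of
transpositions. -/
theorem mem_shuffleGroup_of_permutes_boxes {d : ℕ} {M : Set (Fin d → ℝ)}
    (𝒞 : Finset ((Fin d → ℝ) × (Fin d → ℝ))) (hpos : ∀ c ∈ 𝒞, ∀ i, 0 < c.2 i)
    (hdisj : ∀ c ∈ 𝒞, ∀ c' ∈ 𝒞, ∀ z, z ∈ box c.1 (c.1 + c.2) → z ∈ box c'.1 (c'.1 + c'.2) → c = c')
    (hswap : ∀ x y δ, (x, δ) ∈ 𝒞 → (y, δ) ∈ 𝒞 → x ≠ y → BoxSwap M δ x y)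
    (h : Equiv.Perm (Fin d → ℝ)) (hout : ∀ z, (∀ c ∈ 𝒞, z ∉ box c.1 (c.1 + c.2)) → h z = z)
    (hperm : ∀ c ∈ 𝒞, ∃ y, (y, c.2) ∈ 𝒞 ∧ ∀ z ∈ box c.1 (c.1 + c.2), h z = z + (y - c.1)) :
    h ∈ shuffleGroup M := by
  classical
  have hcorner : ∀ c ∈ 𝒞, c.1 ∈ box c.1 (c.1 + c.2) := fun c hc => mem_box.2 fun i =>
    ⟨le_rfl, by rw [Pi.add_apply]; linarith [hpos c hc i]⟩
  induction hn : (𝒞.filter fun c => h c.1 ≠ c.1).card using Nat.strong_induction_on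
    generalizing h with
  | _ n ih =>
  rcases (𝒞.filter fun c => h c.1 ≠ c.1).eq_empty_or_nonempty with he | ⟨⟨x, δ⟩, hc⟩
  · suffices h = 1 by
      rw [this]
      exact one_mem _
    ext1 z
    by_cases hz : ∀ c ∈ 𝒞, z ∉ box c.1 (c.1 + c.2)
    · exact hout z hz
    push Not at hz
    obtain ⟨c, hc, hzc⟩ := hz
    obtain ⟨y, -, hy⟩ := hperm c hc
    have h1 : h c.1 = c.1 := by
      by_contra hne
      have : c ∈ 𝒞.filter fun c => h c.1 ≠ c.1 := Finset.mem_filter.2 ⟨hc, hne⟩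
      simp [he] at this
    have h2 := hy c.1 (hcorner c hc)
    rw [h1, add_sub_cancel] at h2
    rw [hy z hzc, ← h2, sub_self, add_zero, Equiv.Perm.one_apply]
  obtain ⟨hc, hx⟩ := Finset.mem_filter.1 hc
  obtain ⟨y, hyc, hy⟩ := hperm _ hc
  have hxy : h x = y := by
    rw [hy x (hcorner _ hc), add_sub_cancel]
  have hne : x ≠ y := fun e => hx (hxy.trans e.symm)
  obtain ⟨g, hgG, hg⟩ := hswap x y δ hc hyc hne
  have hxbox := hcorner _ hc
  have hybox := hcorner _ hyc
  have hyx : y ∉ box x (x + δ) := fun h' =>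
    hne (congrArg Prod.fst (hdisj _ hc _ hyc y h' hybox))
  -- Following `h` by the swap of the cell at `x` with its image fixes the cell at `x` and moves no
  -- cell that `h` fixed.
  suffices g * h ∈ shuffleGroup M by
    have := mul_mem (inv_mem hgG) this
    rwa [inv_mul_cancel_left] at this
  refine ih (𝒞.filter fun c => (g * h) c.1 ≠ c.1).card ?_ (g * h) ?_ ?_ rfl
  · rw [← hn]
    refine Finset.card_lt_card ((Finset.ssubset_iff_of_subset ?_).2
      ⟨(x, δ), Finset.mem_filter.2 ⟨hc, hx⟩, ?_⟩)
    · intro c' hc'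
      obtain ⟨hc', hmove⟩ := Finset.mem_filter.1 hc'
      refine Finset.mem_filter.2 ⟨hc', fun hfix => hmove ?_⟩
      rw [Equiv.Perm.mul_apply, hfix, hg, if_neg, if_neg]
      · intro h'
        rw [hdisj _ hc' _ hyc _ (hcorner _ hc') h'] at hfix
        exact hne (h.injective (hxy.trans hfix.symm))
      · intro h'
        rw [hdisj _ hc' _ hc _ (hcorner _ hc') h'] at hfix
        exact hx hfix
    · simp only [Finset.mem_filter, not_and, not_not]
      intro _
      rw [Equiv.Perm.mul_apply, hxy, hg, if_neg hyx, if_pos hybox, add_sub_cancel]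
  · intro z hz
    rw [Equiv.Perm.mul_apply, hout z hz, hg, if_neg (hz _ hc), if_neg (hz _ hyc)]
  · intro c' hc'
    obtain ⟨y', hyc', hy'⟩ := hperm c' hc'
    have hmem : ∀ z ∈ box c'.1 (c'.1 + c'.2), h z ∈ box y' (y' + c'.2) := fun z hz => by
      rw [hy' z hz]
      exact add_mem_box y' hz
    by_cases h1 : (y', c'.2) = (x, δ)
    · obtain ⟨h1, h2⟩ := Prod.mk.inj h1
      refine ⟨y, by rwa [h2], fun z hz => ?_⟩
      have := hmem z hz
      rw [h1, h2] at this
      rw [Equiv.Perm.mul_apply, hg, if_pos this, hy' z hz, h1]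
      abel
    by_cases h2 : (y', c'.2) = (y, δ)
    · obtain ⟨h1, h2⟩ := Prod.mk.inj h2
      refine ⟨x, by rwa [h2], fun z hz => ?_⟩
      have h3 := hmem z hz
      rw [h1, h2] at h3
      rw [Equiv.Perm.mul_apply, hg, if_neg, if_pos h3, hy' z hz, h1]
      · abel
      · intro h4
        exact hne (congrArg Prod.fst (hdisj _ hc _ hyc _ h4 h3))
    · refine ⟨y', hyc', fun z hz => ?_⟩
      have h3 := hmem z hz
      rw [Equiv.Perm.mul_apply, hg, if_neg, if_neg, hy' z hz]
      · exact fun h4 => h2 (hdisj _ hyc' _ hyc _ h3 h4)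
      · exact fun h4 => h1 (hdisj _ hyc' _ hc _ h3 h4)

/-- The coordinate maps are applied successively as slabs. Each `σ i` preserves `[a i, b i)` and
fixes its complement, so the box is preserved and points outside it do not move. -/
theorem exists_product_iet {d : ℕ} {M : Set (Fin d → ℝ)} {a b : Fin d → ℝ} (hM : box a b ⊆ M)
    (σ : Fin d → Equiv.Perm ℝ) (hσ : ∀ i, σ i ∈ iet (a i) (b i)) :
    ∃ g ∈ shuffleGroup M, (∀ z ∈ box a b, g z = fun i => σ i (z i)) ∧
      ∀ z, z ∉ box a b → g z = z := by
  classical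
  suffices ∀ J : Finset (Fin d), ∃ g ∈ shuffleGroup M,
      (∀ z ∈ box a b, g z = J.piecewise (fun i => σ i (z i)) z) ∧ ∀ z, z ∉ box a b → g z = z by
    obtain ⟨g, hg, h1, h2⟩ := this Finset.univ
    exact ⟨g, hg, fun z hz => by rw [h1 z hz, Finset.piecewise_univ], h2⟩
  intro J
  induction J using Finset.induction_on with
  | empty => exact ⟨1, one_mem _, by simp, by simp⟩
  | insert i J hi ih =>
    obtain ⟨g, hg, h1, h2⟩ := ih
    refine ⟨slab i a b (σ i) * g, mul_mem (slab_mem_shuffleGroup hM (hσ i)) hg,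
      fun z hz => ?_, fun z hz => ?_⟩
    · rw [Equiv.Perm.mul_apply, h1 z hz, slab_apply, slabMap, if_pos,
        Finset.piecewise_eq_of_notMem _ _ _ hi, Finset.piecewise_insert]
      intro j _
      by_cases hj : j ∈ J
      · rw [Finset.piecewise_eq_of_mem _ _ _ hj]
        exact iet_apply_mem (hσ j) (mem_box.1 hz j)
      · rw [Finset.piecewise_eq_of_notMem _ _ _ hj]
        exact mem_box.1 hz j
    · rw [Equiv.Perm.mul_apply, h2 z hz, slab_apply, slabMap]
      split_ifs with h
      · rw [iet_apply_of_notMem (hσ i), Function.update_eq_self]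
        intro hzi
        refine hz (mem_box.2 fun j => ?_)
        rcases eq_or_ne j i with rfl | hj
        · exact hzi
        · exact h j hj
      · rfl

theorem mem_shuffleGroup_of_isRectanglePartition {d : ℕ} {M : Set (Fin d → ℝ)}
    (hM : IsMultirectangle M) (hconn : IsPreconnected (interior M)) {f : Equiv.Perm (Fin d → ℝ)}
    (hf : ∀ z, z ∉ M → f z = z) {𝒜 : Set (Set (Fin d → ℝ))} (h𝒜 : IsRectanglePartition M 𝒜)
    (hv : ∀ P ∈ 𝒜, ∃ v : Fin d → ℝ, ∀ z ∈ P, f z = z + v) : f ∈ shuffleGroup M := by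
  classical
  choose! v hv using hv
  have hrect := h𝒜.isRectangle
  choose! a b hab using hrect
  have hfM : ∀ z ∈ M, f z ∈ M := fun z hz => by
    by_contra h
    exact h (by rwa [f.injective (hf _ h)])
  have hmemP : ∀ P ∈ 𝒜, ∀ w, w ∈ P ↔ ∀ i, a P i ≤ w i ∧ w i < b P i := fun P hP w =>
    (Set.ext_iff.1 (hab P hP) w).trans mem_box
  have hQ : ∀ P ∈ 𝒜, ∀ z, z ∈ box (a P + v P) (b P + v P) → ∃ w ∈ P, f w = z := by
    intro P hP z hz
    have hw : z - v P ∈ P := by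
      rw [hmemP P hP]
      rw [mem_box] at hz
      intro i
      have := hz i
      simp only [Pi.add_apply, Pi.sub_apply] at this ⊢
      constructor <;> linarith
    exact ⟨z - v P, hw, by rw [hv P hP _ hw, sub_add_cancel]⟩
  have hQM : ∀ P ∈ 𝒜, box (a P + v P) (b P + v P) ⊆ M := by
    intro P hP z hz
    obtain ⟨w, hw, rfl⟩ := hQ P hP z hz
    exact hfM w (h𝒜.subset hP hw)
  -- One set serves all directions, so that a side of `P` and the corresponding side of its image
  -- are intervals of equal length with endpoints in `S`.
  let S : Finset ℝ := h𝒜.finite.toFinset.biUnion fun P => Finset.univ.biUnion fun i =>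
    {a P i, b P i, a P i + v P i, b P i + v P i}
  have hS : ∀ P ∈ 𝒜, ∀ i, a P i ∈ S ∧ b P i ∈ S ∧ a P i + v P i ∈ S ∧ b P i + v P i ∈ S := by
    intro P hP i
    have : ∀ r ∈ ({a P i, b P i, a P i + v P i, b P i + v P i} : Finset ℝ), r ∈ S := fun r hr =>
      Finset.mem_biUnion.2 ⟨P, by simpa using hP, Finset.mem_biUnion.2 ⟨i, by simp, hr⟩⟩
    exact ⟨this _ (by simp), this _ (by simp), this _ (by simp), this _ (by simp)⟩
  obtain ⟨T, hTfin, hTpos, hTeq, hTcov, hTperm⟩ := exists_tiling S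
  have hσ : ∀ P ∈ 𝒜, ∀ i, ∃ σ ∈ iet (a P i + v P i) (b P i + v P i),
      ∀ s l, T s l → a P i ≤ s → s + l ≤ b P i → ∃ s', T s' l ∧ a P i + v P i ≤ s' ∧
        s' + l ≤ b P i + v P i ∧ ∀ t ∈ Ico s (s + l), σ (t + v P i) = t + (s' - s) := by
    intro P hP i
    obtain ⟨h1, h2, h3, h4⟩ := hS P hP i
    have := hTperm _ h1 _ h2 _ h3 _ h4 (by ring)
    rwa [add_sub_cancel_left] at this
  choose! σ hσiet hσ using hσ
  have hg := fun P (hP : P ∈ 𝒜) => exists_product_iet (hQM P hP) (σ P) (hσiet P hP)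
  choose! g hgG hgin hgout using hg
  -- The images of the rectangles under `f` are pairwise disjoint, so the tile reorderings inside
  -- them combine into one `k`.
  obtain ⟨k, hkG, hkin, hkout⟩ := exists_glue (shuffleGroup M) h𝒜.finite.toFinset
    (fun P => box (a P + v P) (b P + v P)) (by
      intro P hP P' hP' hne
      simp only [Finite.coe_toFinset] at hP hP'
      refine disjoint_left.2 fun z hz hz' => hne ?_
      obtain ⟨w, hw, e⟩ := hQ P hP z hz
      obtain ⟨w', hw', e'⟩ := hQ P' hP' z hz'
      have : w = w' := f.injective (e.trans e'.symm)
      subst this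
      exact h𝒜.disjoint.elim_set hP hP' w hw hw') g
    (fun P hP => hgG P (by simpa using hP)) (fun P hP => hgout P (by simpa using hP))
  suffices k * f ∈ shuffleGroup M by
    have := mul_mem (inv_mem hkG) this
    rwa [inv_mul_cancel_left] at this
  -- The grid cells are the products of tiles contained in `M`. Congruent cells are those with the
  -- same vector of lengths.
  have hfin : {c : (Fin d → ℝ) × (Fin d → ℝ) |
      (∀ i, T (c.1 i) (c.2 i)) ∧ box c.1 (c.1 + c.2) ⊆ M}.Finite := by
    refine ((Set.Finite.pi' fun _ : Fin d => hTfin).image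
      fun p => (fun i => (p i).1, fun i => (p i).2)).subset ?_
    rintro ⟨x, δ⟩ ⟨h, -⟩
    exact ⟨fun i => (x i, δ i), h, rfl⟩
  have hmem : ∀ c, c ∈ hfin.toFinset ↔ (∀ i, T (c.1 i) (c.2 i)) ∧ box c.1 (c.1 + c.2) ⊆ M :=
    fun c => by simp
  have hdisj : ∀ c ∈ hfin.toFinset, ∀ c' ∈ hfin.toFinset, ∀ z, z ∈ box c.1 (c.1 + c.2) →
      z ∈ box c'.1 (c'.1 + c'.2) → c = c' := by
    intro c hc c' hc' z hz hz'
    have := fun i => hTeq _ _ _ _ (z i) (((hmem c).1 hc).1 i) (((hmem c').1 hc').1 i)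
      (mem_box.1 hz i) (mem_box.1 hz' i)
    exact Prod.ext (funext fun i => (this i).1) (funext fun i => (this i).2)
  refine mem_shuffleGroup_of_permutes_boxes hfin.toFinset
    (fun c hc i => hTpos _ _ (((hmem c).1 hc).1 i)) hdisj ?_ (k * f) ?_ ?_
  · intro x y δ hx hy hne
    refine boxSwap_of_connected hM hconn (fun i => hTpos _ _ (((hmem _).1 hx).1 i))
      ((hmem _).1 hx).2 ((hmem _).1 hy).2 (disjoint_left.2 fun z hz hz' => hne ?_)
    exact congrArg Prod.fst (hdisj _ hx _ hy z hz hz')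
  · intro z hz
    have hzM : z ∉ M := by
      intro hzM
      obtain ⟨P, hP, hzP⟩ := h𝒜.exists_mem hzM
      have hzP' := hzP
      rw [hmemP P hP] at hzP'
      have := fun i => hTcov _ (hS P hP i).1 _ (hS P hP i).2.1 (z i) (hzP' i)
      choose s l h1 h2 h3 h4 using this
      refine hz (s, l) ((hmem _).2 ⟨h1, fun w hw => h𝒜.subset hP ?_⟩) (mem_box.2 h4)
      rw [hmemP P hP]
      intro i
      have := mem_box.1 hw i
      exact ⟨(h2 i).trans this.1, this.2.trans_le (h3 i)⟩
    rw [Equiv.Perm.mul_apply, hf z hzM]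
    exact hkout z fun P hP hzP => hzM (hQM P (by simpa using hP) hzP)
  · rintro ⟨x, δ⟩ hc
    obtain ⟨hT, hsub⟩ := (hmem _).1 hc
    have hx : x ∈ box x (x + δ) := mem_box.2 fun i =>
      ⟨le_rfl, by rw [Pi.add_apply]; linarith [hTpos _ _ (hT i)]⟩
    obtain ⟨P, hP, hxP⟩ := h𝒜.exists_mem (hsub hx)
    have hxP' := hxP
    rw [hmemP P hP] at hxP'
    -- A cell whose corner is in `P` lies entirely in `P`: tiles inside the sides of `P` already
    -- cover the coordinates of the corner, and tiles sharing a point coincide.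
    have hin : ∀ i, a P i ≤ x i ∧ x i + δ i ≤ b P i := by
      intro i
      obtain ⟨s, l, h1, h2, h3, h4⟩ := hTcov _ (hS P hP i).1 _ (hS P hP i).2.1 (x i) (hxP' i)
      obtain ⟨e, e'⟩ := hTeq _ _ _ _ (x i) (hT i) h1 (mem_box.1 hx i) h4
      rw [show x i = s from e, show δ i = l from e']
      exact ⟨h2, h3⟩
    have hy := fun i => hσ P hP i (x i) (δ i) (hT i) (hin i).1 (hin i).2
    choose y hyT hy1 hy2 hy3 using hy
    refine ⟨y, (hmem _).2 ⟨hyT, fun w hw => hQM P hP (mem_box.2 fun i => ?_)⟩, fun z hz => ?_⟩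
    · have := mem_box.1 hw i
      exact ⟨(hy1 i).trans this.1, this.2.trans_le (hy2 i)⟩
    · have hz' := mem_box.1 hz
      have hzP : ∀ i, a P i ≤ z i ∧ z i < b P i := fun i =>
        ⟨(hin i).1.trans (hz' i).1, (hz' i).2.trans_le (hin i).2⟩
      have hfz : f z = z + v P := hv P hP z ((hmemP P hP z).2 hzP)
      have hzQ : z + v P ∈ box (a P + v P) (b P + v P) := mem_box.2 fun i =>
        ⟨add_le_add_left (hzP i).1 _, add_lt_add_left (hzP i).2 _⟩
      rw [Equiv.Perm.mul_apply, hfz, hkin P (by simpa using hP) _ hzQ, hgin P hP _ hzQ]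
      ext i
      exact hy3 i (z i) (hz' i)

/-! ### Permutations of `M` and of the ambient space -/

theorem restrictedRotation_of_notMem {u c v t : ℝ} (h₁ : u ≤ c) (h₂ : c ≤ v)
    (ht : t ∉ Ico u v) : restrictedRotation u c v t = t :=
  iet_apply_of_notMem (rotation_mem_iet h₁ h₂ le_rfl le_rfl) t ht

/-- Each generating ambient shuffle fixes the complement of `M` pointwise, so it is the extension by
the identity of a restricted shuffle of `M`. -/
theorem shuffleGroup_le_map {d : ℕ} (M : Set (Fin d → ℝ)) [DecidablePred (· ∈ M)] :
    shuffleGroup M ≤ (Subgroup.closure {f : Equiv.Perm M | IsRestrictedShuffle f}).map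
      Equiv.Perm.ofSubtype := by
  refine (Subgroup.closure_le _).2 ?_
  rintro g ⟨i, a, b, c, h₁, h₂, hM, hg⟩
  have hfix : ∀ x, x ∉ M → g x = x := by
    intro x hx
    by_cases h : ∀ j, j ≠ i → x j ∈ Ico (a j) (b j)
    · rw [(hg x).1 h, restrictedRotation_of_notMem h₁ h₂, Function.update_eq_self]
      intro hxi
      refine hx (hM (mem_box.2 fun j => ?_))
      rcases eq_or_ne j i with rfl | hj
      · exact hxi
      · exact h j hj
    · exact (hg x).2 h
  have hmaps : ∀ x, g x ∈ M ↔ x ∈ M := by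
    intro x
    constructor
    · intro h
      by_contra hx
      rw [hfix x hx] at h
      exact hx h
    · intro hx
      by_contra h
      exact h (by rwa [g.injective (hfix _ h)])
  refine ⟨g.subtypePerm hmaps, Subgroup.subset_closure ⟨i, a, b, c, h₁, h₂, hM, fun x => ?_⟩,
    Equiv.Perm.ofSubtype_subtypePerm _ fun x hx => ?_⟩
  · exact ⟨fun h => (hg x).1 h, fun h => Subtype.ext ((hg x).2 h)⟩
  · by_contra h
    exact hx (hfix x h)

/-! ### Restricted shuffles are rectangle exchanges -/

theorem IsMultirectangle.sdiff_box {d : ℕ} {M : Set (Fin d → ℝ)} (hM : IsMultirectangle M)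
    (a b : Fin d → ℝ) : IsMultirectangle (M \ box a b) := by
  obtain ⟨𝒜, hfin, hrect, rfl⟩ := hM
  have := fun P hP => exists_partition_sdiff (hrect P hP) ⟨a, b, rfl⟩
  choose! 𝒬 h𝒬 using this
  refine ⟨⋃ P ∈ 𝒜, 𝒬 P, hfin.biUnion fun P hP => (h𝒬 P hP).finite, fun Q hQ => ?_, ?_⟩
  · obtain ⟨P, hP, hQ⟩ := mem_iUnion₂.1 hQ
    exact (h𝒬 P hP).isRectangle Q hQ
  · ext x
    simp only [mem_sdiff, mem_sUnion, mem_iUnion]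
    constructor
    · rintro ⟨⟨P, hP, hx⟩, hx'⟩
      obtain ⟨Q, hQ, hxQ⟩ := (h𝒬 P hP).exists_mem ⟨hx, hx'⟩
      exact ⟨Q, ⟨P, hP, hQ⟩, hxQ⟩
    · rintro ⟨Q, ⟨P, hP, hQ⟩, hx⟩
      have := (h𝒬 P hP).subset hQ hx
      exact ⟨⟨P, hP, this.1⟩, this.2⟩

/-- The partition consists of the two halves of the box, cut at `c` in direction `i`, and a
rectangle partition of the rest of `M`, where the shuffle is the identity. -/
theorem IsRestrictedShuffle.isRectangleExchange {d : ℕ} {M : Set (Fin d → ℝ)}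
    (hM : IsMultirectangle M) {f : Equiv.Perm M} (hf : IsRestrictedShuffle f) :
    IsRectangleExchange f := by
  obtain ⟨i, a, b, c, h₁, h₂, hsub, hf⟩ := hf
  obtain ⟨𝒬, h𝒬⟩ := (hM.sdiff_box a b).exists_partition
  have hB₁ : ∀ x, x ∈ box a (Function.update b i c) ↔ x ∈ box a b ∧ x i < c := by
    intro x
    simp only [mem_box]
    constructor
    · intro h
      refine ⟨fun j => ?_, by simpa using (h i).2⟩
      rcases eq_or_ne j i with rfl | hj
      · have := h j
        rw [Function.update_self] at this
        exact ⟨this.1, this.2.trans_le h₂⟩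
      · simpa [hj] using h j
    · rintro ⟨h, h'⟩ j
      rcases eq_or_ne j i with rfl | hj
      · simpa using ⟨(h j).1, h'⟩
      · simpa [hj] using h j
  have hB₂ : ∀ x, x ∈ box (Function.update a i c) b ↔ x ∈ box a b ∧ c ≤ x i := by
    intro x
    simp only [mem_box]
    constructor
    · intro h
      refine ⟨fun j => ?_, by simpa using (h i).1⟩
      rcases eq_or_ne j i with rfl | hj
      · have := h j
        rw [Function.update_self] at this
        exact ⟨h₁.trans this.1, this.2⟩
      · simpa [hj] using h j
    · rintro ⟨h, h'⟩ j
      rcases eq_or_ne j i with rfl | hj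
      · simpa using ⟨h', (h j).2⟩
      · simpa [hj] using h j
  have hd : ∀ Q ∈ 𝒬, Disjoint Q (box a b) := fun Q hQ =>
    disjoint_left.2 fun x hx => (h𝒬.subset hQ hx).2
  have hupd : ∀ (x : Fin d → ℝ) (r : ℝ), Function.update x i (x i + r) = x + Pi.single i r := by
    intro x r
    ext j
    rcases eq_or_ne j i with rfl | hj
    · simp
    · simp [hj]
  refine ⟨insert (box a (Function.update b i c)) (insert (box (Function.update a i c) b) 𝒬),
    ⟨(h𝒬.finite.insert _).insert _, ?_, ?_, ?_⟩, ?_⟩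
  · rintro P (rfl | rfl | hP)
    · exact ⟨_, _, rfl⟩
    · exact ⟨_, _, rfl⟩
    · exact h𝒬.isRectangle P hP
  · refine (h𝒬.disjoint.insert fun Q hQ _ => ?_).insert ?_
    · exact ((hd Q hQ).mono_right fun x hx => ((hB₂ x).1 hx).1).symm
    · rintro Q (rfl | hQ) -
      · exact disjoint_left.2 fun x hx hx' => not_le.2 ((hB₁ x).1 hx).2 ((hB₂ x).1 hx').2
      · exact ((hd Q hQ).mono_right fun x hx => ((hB₁ x).1 hx).1).symm
  · rw [sUnion_insert, sUnion_insert, h𝒬.sUnion_eq]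
    ext x
    simp only [mem_union, hB₁, hB₂, mem_sdiff]
    have := @hsub x
    have := lt_or_ge (x i) c
    tauto
  · rintro P (rfl | rfl | hP)
    · refine ⟨Pi.single i (b i - c), fun x hx => ?_⟩
      obtain ⟨hx, hxc⟩ := (hB₁ _).1 hx
      have hx' := mem_box.1 hx
      rw [(hf x).1 fun j _ => hx' j, restrictedRotation, if_pos ⟨(hx' i).1, hxc⟩, hupd]
    · refine ⟨Pi.single i (-(c - a i)), fun x hx => ?_⟩
      obtain ⟨hx, hxc⟩ := (hB₂ _).1 hx
      have hx' := mem_box.1 hx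
      rw [(hf x).1 fun j _ => hx' j, restrictedRotation, if_neg fun h => not_le.2 h.2 hxc,
        if_pos ⟨hxc, (hx' i).2⟩, sub_eq_add_neg, hupd]
    · refine ⟨0, fun x hx => ?_⟩
      have hx' := (h𝒬.subset hP hx).2
      rw [add_zero]
      by_cases h : ∀ j, j ≠ i → x.1 j ∈ Ico (a j) (b j)
      · rw [(hf x).1 h, restrictedRotation_of_notMem h₁ h₂, Function.update_eq_self]
        intro hxi
        refine hx' (mem_box.2 fun j => ?_)
        rcases eq_or_ne j i with rfl | hj
        · exact hxi
        · exact h j hj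
      · rw [(hf x).2 h]

end RectExchange

theorem mainTheorem8 (d : ℕ) (hd : 1 ≤ d) (M : Set (Fin d → ℝ))
    (hM : RectExchange.IsMultirectangle M) (hconn : IsPreconnected (interior M)) :
    Subgroup.closure {f : Equiv.Perm M | RectExchange.IsRestrictedShuffle f} =
      RectExchange.Rec M hM := by
  classical
  refine le_antisymm ((Subgroup.closure_le _).2 fun f hf =>
    RectExchange.IsRestrictedShuffle.isRectangleExchange hM hf) ?_
  rintro f ⟨𝒜, h𝒜, hf⟩
  -- The decomposition is carried out for the extension of `f` by the identity and pulled back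
  -- through the injective map `Equiv.Perm.ofSubtype`.
  have h : Equiv.Perm.ofSubtype f ∈ RectExchange.shuffleGroup M := by
    refine RectExchange.mem_shuffleGroup_of_isRectanglePartition hM hconn
      (fun z hz => Equiv.Perm.ofSubtype_apply_of_not_mem f hz) h𝒜 fun P hP => ?_
    obtain ⟨v, hv⟩ := hf P hP
    refine ⟨v, fun z hz => ?_⟩
    rw [Equiv.Perm.ofSubtype_apply_of_mem f (h𝒜.subset hP hz)]
    exact hv ⟨z, h𝒜.subset hP hz⟩ hz
  obtain ⟨f', hf', e⟩ := RectExchange.shuffleGroup_le_map M h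
  rwa [← Equiv.Perm.ofSubtype_injective e]
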